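/- Let $X$ be a compact connected Riemann surface of genus $g \ge 2$, where $g = \dim_{\mathbb C} H^0(X, K_X)$ is the dimension of the space of holomorphic $1$-forms on $X$. For $n \ge 1$ let $X^n$ be the $n$-fold Cartesian product, with holomorphic tangent bundle $TX^n$, and for $1 \le j < k \le n$ let $\Delta_{j,k} \subset X^n$ be the divisor of points whose $j$-th and $k$-th coordinates coincide. Then for every $n \ge 1$ and all integers $m_{j,k} \ge 0$ ($1 \le j < k \le n$), $$H^0\Bigl(X^n,\ TX^n \otimes {\mathcal O}_{X^n}\bigl(\textstyle\sum_{1 \le j < k \le n} m_{j,k}\,\Delta_{j,k}\bigr)\Bigr) = 0,$$ that is, the only holomorphic section over $X^n$ of the holomorphic vector bundle $TX^n \otimes {\mathcal O}_{X^n}(\sum_{j<k} m_{j,k}\,\Delta_{j,k})$ is the zero section. -/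

import Mathlib

open scoped Manifold ContDiff Topology Bundle

noncomputable section

/-! ### Tensor products of bundles given by cocycles -/

section Tensor

variable {B : Type*} [TopologicalSpace B] {F : Type*} [NormedAddCommGroup F] [NormedSpace ℂ F]
  {ι κ P : Type*}

/-- The tensor product `E ⊗ L` of a vector bundle `E` (given by a cocycle with model fibre `F`) with
a line bundle `L` (given by a cocycle with model fibre `ℂ`).  Under `F ⊗ ℂ = F` the transition
functions of `E ⊗ L` are those of `E` multiplied by the scalar transition functions of `L`. -/
def tensorLine (E : VectorBundleCore ℂ B F ι) (L : VectorBundleCore ℂ B ℂ κ) :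
    VectorBundleCore ℂ B F (ι × κ) where
  baseSet i := E.baseSet i.1 ∩ L.baseSet i.2
  isOpen_baseSet i := (E.isOpen_baseSet i.1).inter (L.isOpen_baseSet i.2)
  indexAt x := (E.indexAt x, L.indexAt x)
  mem_baseSet_at x := ⟨E.mem_baseSet_at x, L.mem_baseSet_at x⟩
  coordChange i j x := L.coordChange i.2 j.2 x 1 • E.coordChange i.1 j.1 x
  coordChange_self i x hx v := by
    simp [E.coordChange_self i.1 x hx.1, L.coordChange_self i.2 x hx.2]
  continuousOn_coordChange i j := by
    refine ContinuousOn.smul (f := fun x => L.coordChange i.2 j.2 x 1) ?_ ?_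
    · exact ((L.continuousOn_coordChange i.2 j.2).mono
        (fun x hx => ⟨hx.1.2, hx.2.2⟩)).clm_apply continuousOn_const
    · exact (E.continuousOn_coordChange i.1 j.1).mono (fun x hx => ⟨hx.1.1, hx.2.1⟩)
  coordChange_comp i j k x hx v := by
    have h1 := E.coordChange_comp i.1 j.1 k.1 x ⟨⟨hx.1.1.1, hx.1.2.1⟩, hx.2.1⟩ v
    have h2 := L.coordChange_comp i.2 j.2 k.2 x ⟨⟨hx.1.1.2, hx.1.2.2⟩, hx.2.2⟩ 1
    have h3 : L.coordChange j.2 k.2 x (L.coordChange i.2 j.2 x 1)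
        = L.coordChange i.2 j.2 x 1 * L.coordChange j.2 k.2 x 1 := by
      conv_lhs => rw [← mul_one (L.coordChange i.2 j.2 x 1), ← smul_eq_mul, map_smul, smul_eq_mul]
    rw [h3] at h2
    simp only [_root_.smul_apply, map_smul, h1, smul_smul, h2]

/-- The line bundle `⨂ₚ Lₚ^{⊗ mₚ}` of a finite family of line bundles `Lₚ`: its transition functions
are the products of the `mₚ`-th powers of the transition functions of the `Lₚ`. -/
def tensorPowers [Fintype P] (L : P → VectorBundleCore ℂ B ℂ κ) (m : P → ℕ) :
    VectorBundleCore ℂ B ℂ (P → κ) where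
  baseSet i := ⋂ p, (L p).baseSet (i p)
  isOpen_baseSet i := isOpen_iInter_of_finite fun p => (L p).isOpen_baseSet (i p)
  indexAt x p := (L p).indexAt x
  mem_baseSet_at x := Set.mem_iInter.2 fun p => (L p).mem_baseSet_at x
  coordChange i j x :=
    (∏ p, (L p).coordChange (i p) (j p) x 1 ^ m p) • ContinuousLinearMap.id ℂ ℂ
  coordChange_self i x hx v := by
    have : ∀ p, (L p).coordChange (i p) (i p) x 1 = 1 := fun p =>
      (L p).coordChange_self (i p) x (Set.mem_iInter.1 hx p) 1
    simp [this]
  continuousOn_coordChange i j := by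
    refine ContinuousOn.smul (f := fun x => ∏ p, (L p).coordChange (i p) (j p) x 1 ^ m p)
      (continuousOn_finsetProd _ fun p _ => ContinuousOn.pow ?_ _) continuousOn_const
    exact (((L p).continuousOn_coordChange (i p) (j p)).mono
      (fun x hx => ⟨Set.mem_iInter.1 hx.1 p, Set.mem_iInter.1 hx.2 p⟩)).clm_apply continuousOn_const
  coordChange_comp i j k x hx v := by
    have h : ∀ p, (L p).coordChange (j p) (k p) x 1 * (L p).coordChange (i p) (j p) x 1
        = (L p).coordChange (i p) (k p) x 1 := fun p => by
      have h2 := (L p).coordChange_comp (i p) (j p) (k p) x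
        ⟨⟨Set.mem_iInter.1 hx.1.1 p, Set.mem_iInter.1 hx.1.2 p⟩, Set.mem_iInter.1 hx.2 p⟩ 1
      rw [← h2]
      conv_rhs => rw [← mul_one ((L p).coordChange (i p) (j p) x 1), ← smul_eq_mul, map_smul,
        smul_eq_mul, mul_comm]
    simp only [_root_.smul_apply, ContinuousLinearMap.id_apply, smul_eq_mul,
      ← mul_assoc, ← Finset.prod_mul_distrib, ← mul_pow, h]

end Tensor

/-! ### Riemann surfaces, their genus and their self-products -/

section Surface

variable (X : Type*) [TopologicalSpace X] [ChartedSpace ℂ X]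

/-- The space `H⁰(X, K_X)` of holomorphic `1`-forms on a Riemann surface `X`. -/
abbrev HolomorphicOneForm [IsManifold 𝓘(ℂ) ω X] : Type _ :=
  Cₛ^ω⟮𝓘(ℂ); ℂ →L[ℂ] ℂ, fun x : X => TangentSpace 𝓘(ℂ) x →L[ℂ] Bundle.Trivial X ℂ x⟯

/-- The genus of a compact Riemann surface: the dimension of its space of holomorphic `1`-forms. -/
def genus [IsManifold 𝓘(ℂ) ω X] : ℕ := Module.finrank ℂ (HolomorphicOneForm X)

/-- The model `ℂⁿ` of the complex manifold `Xⁿ`. -/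
abbrev productModel (n : ℕ) : ModelWithCorners ℂ (Fin n → ℂ) (ModelPi fun _ : Fin n => ℂ) :=
  ModelWithCorners.pi fun _ : Fin n => 𝓘(ℂ)

variable {X}

theorem analyticAt_chartChange [IsManifold 𝓘(ℂ) ω X] (a b : atlas ℂ X) {p : X}
    (ha : p ∈ a.1.source) (hb : p ∈ b.1.source) : AnalyticAt ℂ (b.1 ∘ a.1.symm) (a.1 p) := by
  have h : ContDiffOn ℂ ω (b.1 ∘ a.1.symm) (a.1.symm ≫ₕ b.1).source := by
    simpa [contDiffGroupoid, mem_groupoid_of_pregroupoid, contDiffPregroupoid] using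
      (mem_groupoid_of_pregroupoid.1 ((contDiffGroupoid ω 𝓘(ℂ)).compatible a.2 b.2)).1
  have hm : a.1 p ∈ (a.1.symm ≫ₕ b.1).source := by
    simp [a.1.map_source ha, a.1.left_inv ha, hb]
  exact (h.contDiffAt ((a.1.symm ≫ₕ b.1).open_source.mem_nhds hm)).analyticAt

/-- The product `Xⁿ` of a Riemann surface is a complex manifold. -/
instance isManifold_selfProduct [IsManifold 𝓘(ℂ) ω X] (n : ℕ) :
    IsManifold (productModel n) ω (Fin n → X) := by
  apply isManifold_of_contDiffOn
  rintro _ _ ⟨a, ha, rfl⟩ ⟨b, hb, rfl⟩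
  rw [contDiffOn_pi]
  rintro i z ⟨hz, -⟩
  have hz' : z i ∈ (a i).target ∧ (a i).symm (z i) ∈ (b i).source := by
    have h1 := hz.1 i trivial
    have h2 := hz.2 i trivial
    exact ⟨h1, h2⟩
  have h := analyticAt_chartChange (X := X) ⟨a i, ha i trivial⟩ ⟨b i, hb i trivial⟩
    ((a i).map_target hz'.1) hz'.2
  rw [(a i).right_inv hz'.1] at h
  exact (h.contDiffAt.comp z (contDiff_apply ℂ ℂ i).contDiffAt).contDiffWithinAt

/-! ### The line bundle of a diagonal -/

variable {n : ℕ}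

/-- The open cover of `Xⁿ` on which local equations of `Δ_{j,k} = {x | x j = x k}` are given: the
complement of `Δ_{j,k}` (index `none`), and, for each chart `a` of `X`, the set of points whose
`j`-th and `k`-th coordinates both lie in the domain of `a` (index `some a`). -/
def diagonalCover (j k : Fin n) : Option (atlas ℂ X) → Set (Fin n → X)
  | none => {x | x j ≠ x k}
  | some a => {x | x j ∈ a.1.source ∧ x k ∈ a.1.source}

/-- The local equations of the divisor `Δ_{j,k}` on the sets of the cover: `1` on the complement of
`Δ_{j,k}` and `a (x j) - a (x k)` for a chart `a`. -/
def diagonalEquation (j k : Fin n) : Option (atlas ℂ X) → (Fin n → X) → ℂ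
  | none, _ => 1
  | some a, x => a.1 (x j) - a.1 (x k)

/-- The derivative at `p` of the change of charts `b ∘ a⁻¹` (the value `1` when an index is `none`
is never used on the cover). -/
def chartChangeDeriv : Option (atlas ℂ X) → Option (atlas ℂ X) → X → ℂ
  | some a, some b, p => deriv (b.1 ∘ a.1.symm) (a.1 p)
  | _, _, _ => 1

open Classical in
/-- The transition functions of the line bundle `O(Δ_{j,k})`: the quotients `f_b / f_a` of the local
equations of `Δ_{j,k}`, whose holomorphic extension across `Δ_{j,k}` is the derivative of the change
of charts. -/
def diagonalTransition (j k : Fin n) (a b : Option (atlas ℂ X)) (x : Fin n → X) : ℂ :=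
  if x j = x k then chartChangeDeriv a b (x j)
  else diagonalEquation j k b x / diagonalEquation j k a x

theorem diagonalEquation_ne_zero (j k : Fin n) (a : Option (atlas ℂ X)) {x : Fin n → X}
    (hx : x ∈ diagonalCover j k a) (h : x j ≠ x k) : diagonalEquation j k a x ≠ 0 := by
  cases a with
  | none => exact one_ne_zero
  | some a => exact sub_ne_zero.2 fun e => h (a.1.injOn hx.1 hx.2 e)

theorem isOpen_diagonalCover [T2Space X] (j k : Fin n) (a : Option (atlas ℂ X)) :
    IsOpen (diagonalCover j k a) := by
  cases a with
  | none => exact isOpen_ne_fun (continuous_apply j) (continuous_apply k)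
  | some a =>
    have hj : Continuous fun x : Fin n → X => x j := continuous_apply j
    have hk : Continuous fun x : Fin n → X => x k := continuous_apply k
    exact (a.1.open_source.preimage hj).inter (a.1.open_source.preimage hk)

theorem continuousOn_diagonalEquation (j k : Fin n) (a : Option (atlas ℂ X)) :
    ContinuousOn (diagonalEquation j k a) (diagonalCover j k a) := by
  cases a with
  | none => exact continuousOn_const
  | some a =>
    exact (a.1.continuousOn.comp (continuous_apply j).continuousOn fun x hx => hx.1).sub
      (a.1.continuousOn.comp (continuous_apply k).continuousOn fun x hx => hx.2)

/-- The local equations of `Δ_{j,k}` are the components of a section of `O(Δ_{j,k})`. -/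
theorem diagonalTransition_mul_equation (j k : Fin n) (a b : Option (atlas ℂ X)) {x : Fin n → X}
    (ha : x ∈ diagonalCover j k a) (hb : x ∈ diagonalCover j k b) :
    diagonalTransition j k a b x * diagonalEquation j k a x = diagonalEquation j k b x := by
  unfold diagonalTransition
  split_ifs with h
  · cases a with
    | none => exact absurd h ha
    | some a =>
      cases b with
      | none => exact absurd h hb
      | some b => simp [diagonalEquation, h]
  · exact div_mul_cancel₀ _ (diagonalEquation_ne_zero j k a ha h)

theorem continuousOn_diagonalTransition [T2Space X] [IsManifold 𝓘(ℂ) ω X] (j k : Fin n)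
    (a b : Option (atlas ℂ X)) :
    ContinuousOn (diagonalTransition j k a b) (diagonalCover j k a ∩ diagonalCover j k b) := by
  intro x hx
  by_cases h : x j = x k
  · cases a with
    | none => exact absurd h hx.1
    | some a =>
    cases b with
    | none => exact absurd h hx.2
    | some b =>
    set f : ℂ → ℂ := b.1 ∘ a.1.symm with hf
    have hA : AnalyticAt ℂ f (a.1 (x j)) := analyticAt_chartChange a b hx.1.1 hx.2.1
    have hxval : diagonalTransition j k (some a) (some b) x = deriv f (a.1 (x j)) := by
      simp [diagonalTransition, h, chartChangeDeriv, hf]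
    have hj : ContinuousAt (fun y : Fin n → X => a.1 (y j)) x :=
      (a.1.continuousAt hx.1.1).comp (f := fun y : Fin n → X => y j) (continuous_apply j).continuousAt
    have hk : ContinuousAt (fun y : Fin n → X => a.1 (y k)) x :=
      (a.1.continuousAt hx.1.2).comp (f := fun y : Fin n → X => y k) (continuous_apply k).continuousAt
    have hd : ContinuousAt (fun y : Fin n → X => deriv f (a.1 (y j))) x :=
      hA.deriv.continuousAt.comp (f := fun y : Fin n → X => a.1 (y j)) hj
    have hs := hA.hasStrictDerivAt.isLittleO
    refine ContinuousAt.continuousWithinAt ?_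
    rw [Metric.continuousAt_iff']
    intro ε hε
    have hpair : Filter.Tendsto (fun y : Fin n → X => (a.1 (y j), a.1 (y k))) (𝓝 x)
        (𝓝 (a.1 (x j), a.1 (x j))) := by
      have h2 := hj.tendsto.prodMk_nhds hk.tendsto
      simp only [← h] at h2
      exact h2
    have hev := hpair.eventually (hs.def (half_pos hε))
    have hU : ∀ᶠ y in 𝓝 x, y ∈ diagonalCover j k (some a) ∩ diagonalCover j k (some b) :=
      ((isOpen_diagonalCover j k (some a)).inter (isOpen_diagonalCover j k (some b))).mem_nhds hx
    filter_upwards [hev, hU, Metric.continuousAt_iff'.1 hd ε hε] with y hy hyU hyd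
    rw [hxval]
    by_cases hyjk : y j = y k
    · simpa [diagonalTransition, hyjk, chartChangeDeriv, hf] using hyd
    · have hne : a.1 (y j) - a.1 (y k) ≠ 0 := diagonalEquation_ne_zero j k (some a) hyU.1 hyjk
      have e : diagonalTransition j k (some a) (some b) y - deriv f (a.1 (x j)) =
          (f (a.1 (y j)) - f (a.1 (y k)) -
            (a.1 (y j) - a.1 (y k)) * deriv f (a.1 (x j))) / (a.1 (y j) - a.1 (y k)) := by
        simp only [diagonalTransition, hyjk, if_false, diagonalEquation, hf, Function.comp_apply,
          a.1.left_inv hyU.1.1, a.1.left_inv hyU.1.2]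
        field_simp
      rw [dist_eq_norm, e, norm_div, div_lt_iff₀ (norm_pos_iff.2 hne)]
      have hpos := norm_pos_iff.2 hne
      have hy' : ‖f (a.1 (y j)) - f (a.1 (y k)) -
            (a.1 (y j) - a.1 (y k)) * deriv f (a.1 (x j))‖ ≤ ε / 2 * ‖a.1 (y j) - a.1 (y k)‖ := by
        simpa [mul_comm] using hy
      nlinarith
  · have hN : {y : Fin n → X | y j ≠ y k} ∈ 𝓝 x :=
      (isOpen_ne_fun (continuous_apply j) (continuous_apply k)).mem_nhds h
    have hq : ContinuousWithinAt
        (fun y => diagonalEquation j k b y / diagonalEquation j k a y)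
        (diagonalCover j k a ∩ diagonalCover j k b) x :=
      ((continuousOn_diagonalEquation j k b x hx.2).mono Set.inter_subset_right).div
        ((continuousOn_diagonalEquation j k a x hx.1).mono Set.inter_subset_left)
        (diagonalEquation_ne_zero j k a hx.1 h)
    refine hq.congr_of_eventuallyEq ?_ (by simp [diagonalTransition, h])
    filter_upwards [mem_nhdsWithin_of_mem_nhds hN] with y hy
    have hy' : ¬ y j = y k := hy
    simp [diagonalTransition, hy']

theorem diagonalTransition_comp [IsManifold 𝓘(ℂ) ω X] (j k : Fin n)
    (a b c : Option (atlas ℂ X)) {x : Fin n → X} (ha : x ∈ diagonalCover j k a)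
    (hb : x ∈ diagonalCover j k b) (hc : x ∈ diagonalCover j k c) :
    diagonalTransition j k b c x * diagonalTransition j k a b x = diagonalTransition j k a c x := by
  unfold diagonalTransition
  split_ifs with h
  · cases a with
    | none => exact absurd h ha
    | some a =>
    cases b with
    | none => exact absurd h hb
    | some b =>
    cases c with
    | none => exact absurd h hc
    | some c =>
    have h1 := (analyticAt_chartChange a b ha.1 hb.1).differentiableAt
    have h2 := (analyticAt_chartChange b c hb.1 hc.1).differentiableAt
    have e : (b.1 ∘ a.1.symm) (a.1 (x j)) = b.1 (x j) := by simp [a.1.left_inv ha.1]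
    have h3 := deriv_comp (h₂ := c.1 ∘ b.1.symm) (h := b.1 ∘ a.1.symm) (a.1 (x j)) (e ▸ h2) h1
    rw [e] at h3
    simp only [chartChangeDeriv]
    rw [← h3]
    refine Filter.EventuallyEq.deriv_eq ?_
    have hm : a.1 (x j) ∈ (a.1.symm ≫ₕ b.1).source := by
      simp [a.1.map_source ha.1, a.1.left_inv ha.1, hb.1]
    filter_upwards [(a.1.symm ≫ₕ b.1).open_source.mem_nhds hm] with z hz
    simp only [OpenPartialHomeomorph.trans_source, Set.mem_inter_iff, Set.mem_preimage] at hz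
    simp [b.1.left_inv hz.2]
  · have := diagonalEquation_ne_zero j k a ha h
    have := diagonalEquation_ne_zero j k b hb h
    field_simp

variable (X) in
open Classical in
/-- The line bundle `O(Δ_{j,k})` on `Xⁿ`. -/
def diagonalLineBundle [T2Space X] [IsManifold 𝓘(ℂ) ω X] (j k : Fin n) :
    VectorBundleCore ℂ (Fin n → X) ℂ (Option (atlas ℂ X)) where
  baseSet := diagonalCover j k
  isOpen_baseSet := isOpen_diagonalCover j k
  indexAt x := if x j = x k then some (achart ℂ (x j)) else none
  mem_baseSet_at x := by
    split_ifs with h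
    · exact ⟨mem_chart_source ℂ (x j), h ▸ mem_chart_source ℂ (x j)⟩
    · exact h
  coordChange a b x := diagonalTransition j k a b x • ContinuousLinearMap.id ℂ ℂ
  coordChange_self a x hx v := by
    have h1 : diagonalTransition j k a a x = 1 := by
      unfold diagonalTransition
      split_ifs with h
      · cases a with
        | none => rfl
        | some a =>
          have : a.1 ∘ a.1.symm =ᶠ[𝓝 (a.1 (x j))] id := by
            filter_upwards [a.1.open_target.mem_nhds (a.1.map_source hx.1)] with z hz
            simp [a.1.right_inv hz]
          simp [chartChangeDeriv, this.deriv_eq]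
      · exact div_self (diagonalEquation_ne_zero j k a hx h)
    simp [h1]
  continuousOn_coordChange a b :=
    (continuousOn_diagonalTransition j k a b).smul continuousOn_const
  coordChange_comp a b c x hx v := by
    simp [← diagonalTransition_comp j k a b c hx.1.1 hx.1.2 hx.2, mul_assoc]

/-- The pairs `(j, k)` with `j < k`, which index the diagonals of `Xⁿ`. -/
abbrev DiagonalPair (n : ℕ) : Type := {p : Fin n × Fin n // p.1 < p.2}

variable (X) in
/-- The line bundle `O(∑_{j < k} m_{j,k} Δ_{j,k})` on `Xⁿ`. -/
def diagonalDivisorBundle [T2Space X] [IsManifold 𝓘(ℂ) ω X] (m : DiagonalPair n → ℕ) :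
    VectorBundleCore ℂ (Fin n → X) ℂ (DiagonalPair n → Option (atlas ℂ X)) :=
  tensorPowers (fun p : DiagonalPair n => diagonalLineBundle X p.1.1 p.1.2) m

variable (X) in
/-- The vector bundle `TXⁿ ⊗ O(∑_{j < k} m_{j,k} Δ_{j,k})` on `Xⁿ`. -/
def twistedTangentBundle [T2Space X] [IsManifold 𝓘(ℂ) ω X] (m : DiagonalPair n → ℕ) :
    VectorBundleCore ℂ (Fin n → X) (Fin n → ℂ) (atlas (ModelPi fun _ : Fin n => ℂ) (Fin n → X) ×
      (DiagonalPair n → Option (atlas ℂ X))) :=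
  tensorLine (tangentBundleCore (productModel n) (Fin n → X)) (diagonalDivisorBundle X m)

end Surface

end

/-! Since the genus is at least 2, some nonzero holomorphic one-form w vanishes at a point q.
Pairing the i-th component of a section with w in the i-th variable gives a function on Xⁿ that is
holomorphic off the diagonals, with poles bounded by the given divisor. Such functions are constant
(`HasDiagonalPoles.exists_eq_const`). Putting q in the i-th place shows that the constant is 0, so
the component vanishes wherever the points are distinct and w(xᵢ) ≠ 0, which is a dense set.

Constancy is an induction on the number of factors and, inside it, on the divisor D. Take a diagonal
Δ_{j,k} in D. Its normal bundle is the tangent bundle of X, so the coefficient of order r of h along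
it, where r counts its copies in D, is an r-th power of a tangent vector at the common point
(`IsLocalNumerator.eventually_restrict`). Contracting with w^r yields a function on a product with
one factor fewer, again with poles along diagonals (`HasDiagonalPoles.restrict`). By induction it is
constant, and it is 0 because w(q) = 0 and r > 0. Hence the local numerators of h vanish on Δ_{j,k}
and are divisible by z_j - z_k (`AnalyticAt.exists_eq_sub_mul`), so one copy of Δ_{j,k} can be
dropped from D. When D is empty, h extends holomorphically to a power of a compact connected
surface. -/

noncomputable section

/-! ### Division of analytic functions by a linear form -/

section Division

variable {𝕜 E F : Type*} [NontriviallyNormedField 𝕜] [NormedAddCommGroup E] [NormedSpace 𝕜 E]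
  [NormedAddCommGroup F] [NormedSpace 𝕜 F]

/-- The `m`-th term of the power series of the quotient of `∑ pₙ` by a linear form with kernel
`range B`, where `B` is the projection along `e`. -/
def quotientSeries (p : FormalMultilinearSeries 𝕜 E F) (B : E →L[𝕜] E) (e : E) :
    FormalMultilinearSeries 𝕜 E F := fun m =>
  ∑ i : Fin (m + 1), ((p (m + 1)).compContinuousLinearMap
    (fun l => if l ≤ i then ContinuousLinearMap.id 𝕜 E else B)).curryMid i e

/-- Telescoping sum: the arguments `b` are replaced by `y` one slot at a time, from the left. -/
theorem map_const_sub_map_const {n : ℕ} (p : ContinuousMultilinearMap 𝕜 (fun _ : Fin n => E) F)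
    (y b : E) :
    p (fun _ => y) - p (fun _ => b) =
      ∑ i : Fin n, p (fun l => if l < i then y else if l = i then y - b else b) := by
  have h : ∀ i : Fin n, p (fun l => if l < i then y else if l = i then y - b else b) =
      p (fun l => if (l : ℕ) < i + 1 then y else b) - p (fun l => if (l : ℕ) < i then y else b) := by
    intro i
    have h1 : (fun l => if l < i then y else if l = i then y - b else b) =
        Function.update (fun l : Fin n => if (l : ℕ) < i then y else b) i (y - b) := by
      funext l
      by_cases hl : l = i
      · subst hl; simp
      · simp [hl]
    rw [h1, p.map_update_sub]
    congr 2
    · funext l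
      by_cases hl : l = i
      · subst hl; simp
      · have : (l : ℕ) ≠ i := fun h => hl (Fin.ext h)
        have h3 : (l : ℕ) < i + 1 ↔ (l : ℕ) < i := by omega
        simp [hl, h3]
    · funext l
      by_cases hl : l = i
      · subst hl; simp
      · simp [hl]
  simp_rw [h]
  rw [Fin.sum_univ_eq_sum_range (fun i => p (fun l => if (l : ℕ) < i + 1 then y else b) -
    p (fun l => if (l : ℕ) < i then y else b)) n,
    Finset.sum_range_sub (fun i => p (fun l => if (l : ℕ) < i then y else b))]
  simp

/-- In the telescoping sum the slot `i` holds `y - B y = ℓ y • e`, and the scalar comes out by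
linearity. In `quotientSeries` the condition `l ≤ i` leaves the identity in slot `i` itself, so that
slot receives `e` and not `B e`. -/
theorem quotientSeries_apply (p : FormalMultilinearSeries 𝕜 E F) (B : E →L[𝕜] E) (e : E)
    (ℓ : E →L[𝕜] 𝕜) (hB : ∀ z, z - B z = ℓ z • e) (m : ℕ) (y : E) :
    ℓ y • quotientSeries p B e m (fun _ => y) =
      p (m + 1) (fun _ => y) - p (m + 1) (fun _ => B y) := by
  rw [map_const_sub_map_const, quotientSeries, _root_.sum_apply,
    Finset.smul_sum]
  refine Finset.sum_congr rfl fun i _ => ?_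
  rw [hB]
  have h1 : (fun l : Fin (m + 1) => if l < i then y else if l = i then ℓ y • e else B y) =
      Function.update (fun l : Fin (m + 1) => if l < i then y else B y) i (ℓ y • e) := by
    funext l
    by_cases hl : l = i
    · subst hl; simp
    · simp [hl]
  rw [h1, (p (m + 1)).map_update_smul, ContinuousMultilinearMap.curryMid_apply,
    ContinuousMultilinearMap.compContinuousLinearMap_apply]
  congr 2
  funext l
  by_cases hl : l = i
  · subst hl; simp
  · obtain ⟨l', rfl⟩ := Fin.exists_succAbove_eq hl
    have h2 : i.succAbove l' ≤ i ↔ i.succAbove l' < i := (Ne.le_iff_lt hl)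
    by_cases h3 : i.succAbove l' < i <;> simp [hl, h2, h3]

theorem norm_quotientSeries_le (p : FormalMultilinearSeries 𝕜 E F) (B : E →L[𝕜] E) (e : E) (m : ℕ) :
    ‖quotientSeries p B e m‖ ≤ (m + 1) * (‖p (m + 1)‖ * (max 1 ‖B‖) ^ (m + 1) * ‖e‖) := by
  refine (norm_sum_le _ _).trans ?_
  refine (Finset.sum_le_card_nsmul _ _ (‖p (m + 1)‖ * (max 1 ‖B‖) ^ (m + 1) * ‖e‖) ?_).trans_eq
    (by simp)
  intro i _
  refine (ContinuousLinearMap.le_opNorm _ _).trans ?_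
  gcongr
  rw [ContinuousMultilinearMap.norm_curryMid]
  refine (ContinuousMultilinearMap.norm_compContinuousLinearMap_le _ _).trans ?_
  gcongr
  refine (Finset.prod_le_prod (g := fun _ => max 1 ‖B‖) (fun _ _ => norm_nonneg _) ?_).trans_eq
    (by simp)
  intro l _
  split_ifs
  · exact ContinuousLinearMap.norm_id_le.trans (le_max_left _ _)
  · exact le_max_right _ _

theorem quotientSeries_radius_pos {p : FormalMultilinearSeries 𝕜 E F} (hp : 0 < p.radius)
    (B : E →L[𝕜] E) (e : E) : 0 < (quotientSeries p B e).radius := by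
  obtain ⟨r, hr0, hr⟩ := ENNReal.lt_iff_exists_nnreal_btwn.1 hp
  have hr0' : (0 : ℝ) < r := by exact_mod_cast hr0
  obtain ⟨M, hM, hMp⟩ := p.norm_mul_pow_le_of_lt_radius hr
  set C : NNReal := max 1 ‖B‖₊ with hC
  have hCc : (C : ℝ) = max 1 ‖B‖ := by simp [hC]
  have hC0 : (0 : ℝ) < C := by rw [hCc]; positivity
  have hρ : 0 < r / (2 * C) := by
    have : (0 : ℝ) < (r / (2 * C) : NNReal) := by push_cast; positivity
    exact_mod_cast this
  -- In the radius `r / (2 * C)`, the 2 absorbs the factor `m + 1 ≤ 2 ^ m` and `C` absorbs the norms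
  -- of the copies of `B`.
  refine lt_of_lt_of_le (by exact_mod_cast hρ)
    ((quotientSeries p B e).le_radius_of_bound (M * C * ‖e‖ / r) (r := r / (2 * C)) fun m => ?_)
  have h1 := norm_quotientSeries_le p B e m
  rw [← hCc] at h1
  have h2 : ((m : ℝ) + 1) ≤ 2 ^ m := by exact_mod_cast Nat.lt_two_pow_self (n := m)
  have h3 := hMp (m + 1)
  push_cast
  calc ‖quotientSeries p B e m‖ * (r / (2 * C) : ℝ) ^ m
      ≤ ((m + 1) * (‖p (m + 1)‖ * C ^ (m + 1) * ‖e‖)) * (r / (2 * C) : ℝ) ^ m := by gcongr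
    _ ≤ (2 ^ m * (‖p (m + 1)‖ * C ^ (m + 1) * ‖e‖)) * (r / (2 * C) : ℝ) ^ m := by gcongr
    _ = (‖p (m + 1)‖ * r ^ (m + 1)) * (C * ‖e‖ / r) := by
        rw [div_pow, mul_pow]; field_simp; ring
    _ ≤ M * (C * ‖e‖ / r) := by gcongr
    _ = M * C * ‖e‖ / r := by ring

/-- An analytic function vanishing on the kernel of a linear form `ℓ` is divisible by `ℓ`. -/
theorem AnalyticAt.exists_eq_smul_of_eq_zero [CompleteSpace F] {f : E → F} {z₀ e : E}
    {ℓ : E →L[𝕜] 𝕜} (hf : AnalyticAt 𝕜 f z₀) (he : ℓ e = 1) (hz₀ : ℓ z₀ = 0)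
    (h0 : ∀ᶠ z in 𝓝 z₀, ℓ z = 0 → f z = 0) :
    ∃ q : E → F, AnalyticAt 𝕜 q z₀ ∧ ∀ᶠ z in 𝓝 z₀, f z = ℓ z • q z := by
  obtain ⟨p, hp⟩ := hf
  set B : E →L[𝕜] E := ContinuousLinearMap.id 𝕜 E - ℓ.smulRight e with hBdef
  have hB : ∀ z, z - B z = ℓ z • e := fun z => by simp [hBdef]
  have hℓB : ∀ z, ℓ (B z) = 0 := fun z => by simp [hBdef, he]
  have hq := (quotientSeries p B e).hasFPowerSeriesOnBall
    (quotientSeries_radius_pos hp.radius_pos B e)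
  set q := quotientSeries p B e with hqdef
  refine ⟨fun z => q.sum (z - z₀), ?_, ?_⟩
  · have h1 : AnalyticAt 𝕜 q.sum (z₀ - z₀) := by rw [sub_self]; exact hq.analyticAt
    exact h1.comp (f := fun z => z - z₀) (by fun_prop)
  have hsub : Filter.Tendsto (fun z => z - z₀) (𝓝 z₀) (𝓝 0) := by
    have : ContinuousAt (fun z : E => z - z₀) z₀ := by fun_prop
    simpa [ContinuousAt] using this
  have hBt : Filter.Tendsto (fun y => B y) (𝓝 0) (𝓝 0) := by
    simpa using B.continuous.tendsto 0
  have hadd : Filter.Tendsto (fun y => z₀ + y) (𝓝 0) (𝓝 z₀) := by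
    have : ContinuousAt (fun y : E => z₀ + y) 0 := by fun_prop
    simpa [ContinuousAt] using this
  have hsum : ∀ᶠ y in 𝓝 (0 : E), HasSum (fun n : ℕ => p n fun _ : Fin n => y) (f (z₀ + y)) :=
    hp.eventually_hasSum
  filter_upwards [hsub.eventually hsum, hsub.eventually (hBt.eventually hsum),
    hsub.eventually (hBt.eventually (hadd.eventually h0)),
    hsub.eventually (hq.hasFPowerSeriesAt.eventually_hasSum)] with z h1 h2 h3 h4
  set y := z - z₀ with hy
  have hzy : z₀ + y = z := by simp [hy]
  have hℓy : ℓ y = ℓ z := by simp [hy, hz₀]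
  -- The point `z₀ + B y` lies in the kernel of `ℓ`, so `f` vanishes there and `f (z₀ + y)` is the
  -- sum of the differences of the two series. Their terms of degree 0 cancel.
  rw [h3 (by simp [hz₀, hℓB])] at h2
  have h5 := h1.sub h2
  rw [sub_zero, ← hasSum_nat_add_iff' 1] at h5
  have h6 := h4.const_smul (ℓ y)
  rw [zero_add] at h6
  have h7 : p 0 (fun _ => y) = p 0 fun _ => B y := by congr 1; funext i; exact i.elim0
  simp only [Finset.sum_range_one, h7, sub_self, sub_zero] at h5
  have h8 : (fun n : ℕ => p (n + 1) (fun _ => y) - p (n + 1) fun _ => B y) =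
      fun n => ℓ y • q n fun _ => y := by
    funext n; exact (quotientSeries_apply p B e ℓ hB n y).symm
  simp only [hqdef] at h6 h8 ⊢
  rw [h8] at h5
  rw [← hzy, h5.unique h6, hzy, hℓy]

theorem AnalyticAt.exists_eq_sub_mul {ι : Type*} [Fintype ι] {f : (ι → ℂ) → ℂ} {z₀ : ι → ℂ}
    {j k : ι} (hjk : j ≠ k) (hf : AnalyticAt ℂ f z₀) (hz₀ : z₀ j = z₀ k)
    (h0 : ∀ᶠ z in 𝓝 z₀, z j = z k → f z = 0) :
    ∃ q : (ι → ℂ) → ℂ, AnalyticAt ℂ q z₀ ∧ ∀ᶠ z in 𝓝 z₀, f z = (z j - z k) * q z := by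
  classical
  let ℓ : (ι → ℂ) →L[ℂ] ℂ := ContinuousLinearMap.proj (R := ℂ) (φ := fun _ : ι => ℂ) j -
    ContinuousLinearMap.proj (R := ℂ) (φ := fun _ : ι => ℂ) k
  have hℓ : ∀ z, ℓ z = z j - z k := fun z => rfl
  refine hf.exists_eq_smul_of_eq_zero (ℓ := ℓ) (e := Pi.single j 1) (by simp [hℓ, hjk.symm])
    (by simp [hℓ, hz₀]) ?_
  filter_upwards [h0] with z hz h
  exact hz (sub_eq_zero.1 h)

end Division

/-! ### Coefficients of holomorphic one-forms -/

section Forms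

variable {X : Type*} [TopologicalSpace X] [ChartedSpace ℂ X]

/-- The derivative at `x` of the change of charts from the preferred chart at `q` to the one
at `x`. -/
def preferredChartDeriv (q x : X) : ℂ := deriv (chartAt ℂ x ∘ (chartAt ℂ q).symm) (chartAt ℂ q x)

/-- `w` is the coefficient function `x ↦ ω x (∂/∂z)` of a holomorphic one-form, where `z` is the
preferred chart at `x`. -/
def IsFormCoefficient (w : X → ℂ) : Prop :=
  ∀ q, ∃ g : ℂ → ℂ, AnalyticAt ℂ g (chartAt ℂ q q) ∧
    ∀ᶠ x in 𝓝 q, g (chartAt ℂ q x) = w x * preferredChartDeriv q x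

theorem eventually_mem_chart_source (q : X) : ∀ᶠ x in 𝓝 q, x ∈ (chartAt ℂ q).source :=
  (chartAt ℂ q).open_source.mem_nhds (mem_chart_source ℂ q)

theorem analyticAt_preferredChartChange [IsManifold 𝓘(ℂ) ω X] {q x : X}
    (hx : x ∈ (chartAt ℂ q).source) :
    AnalyticAt ℂ (chartAt ℂ x ∘ (chartAt ℂ q).symm) (chartAt ℂ q x) :=
  analyticAt_chartChange (achart ℂ q) (achart ℂ x) hx (mem_chart_source ℂ x)

theorem deriv_mul_preferredChartDeriv [IsManifold 𝓘(ℂ) ω X] {q x : X}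
    (hx : x ∈ (chartAt ℂ q).source) :
    deriv (chartAt ℂ q ∘ (chartAt ℂ x).symm) (chartAt ℂ x x) * preferredChartDeriv q x = 1 := by
  have h1 := (analyticAt_preferredChartChange hx).differentiableAt
  have h2 := (analyticAt_chartChange (achart ℂ x) (achart ℂ q) (mem_chart_source ℂ x)
    hx).differentiableAt
  simp only [coe_achart] at h2
  have e : (chartAt ℂ x ∘ (chartAt ℂ q).symm) (chartAt ℂ q x) = chartAt ℂ x x := by
    simp [(chartAt ℂ q).left_inv hx]
  have h3 := deriv_comp (h₂ := chartAt ℂ q ∘ (chartAt ℂ x).symm)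
    (h := chartAt ℂ x ∘ (chartAt ℂ q).symm) (chartAt ℂ q x) (e ▸ h2) h1
  have h4 : (chartAt ℂ q ∘ (chartAt ℂ x).symm) ∘ (chartAt ℂ x ∘ (chartAt ℂ q).symm)
      =ᶠ[𝓝 (chartAt ℂ q x)] id := by
    have hm : chartAt ℂ q x ∈ ((chartAt ℂ q).symm ≫ₕ chartAt ℂ x).source := by
      simp [(chartAt ℂ q).map_source hx, (chartAt ℂ q).left_inv hx]
    filter_upwards [((chartAt ℂ q).symm ≫ₕ chartAt ℂ x).open_source.mem_nhds hm] with z hz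
    simp only [OpenPartialHomeomorph.trans_source, Set.mem_inter_iff, Set.mem_preimage] at hz
    simp [(chartAt ℂ x).left_inv hz.2, (chartAt ℂ q).right_inv hz.1]
  rw [h4.deriv_eq, deriv_id, e] at h3
  exact h3.symm

theorem preferredChartDeriv_ne_zero [IsManifold 𝓘(ℂ) ω X] {q x : X}
    (hx : x ∈ (chartAt ℂ q).source) : preferredChartDeriv q x ≠ 0 :=
  right_ne_zero_of_mul_eq_one (deriv_mul_preferredChartDeriv hx)

instance neBot_nhdsWithin_ne_of_chartedSpace (x : X) : (𝓝[≠] x).NeBot := by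
  have h := (chartAt ℂ x).symm.continuousAt ((chartAt ℂ x).map_source (mem_chart_source ℂ x))
  have hx := mem_chart_source ℂ x
  rw [ContinuousAt, (chartAt ℂ x).left_inv hx] at h
  have ht : Filter.Tendsto (chartAt ℂ x).symm (𝓝[≠] (chartAt ℂ x x)) (𝓝[≠] x) := by
    refine tendsto_nhdsWithin_iff.2 ⟨h.mono_left nhdsWithin_le_nhds, ?_⟩
    filter_upwards [self_mem_nhdsWithin, nhdsWithin_le_nhds
      ((chartAt ℂ x).open_target.mem_nhds ((chartAt ℂ x).map_source hx))] with z hz hz' h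
    apply hz
    have h : (chartAt ℂ x).symm z = x := h
    rw [Set.mem_singleton_iff, ← (chartAt ℂ x).right_inv hz', h]
  exact ht.neBot

variable {w : X → ℂ}

theorem IsFormCoefficient.eventually_eq_zero_or [IsManifold 𝓘(ℂ) ω X] (hw : IsFormCoefficient w)
    (q : X) : (∀ᶠ x in 𝓝 q, w x = 0) ∨ ∀ᶠ x in 𝓝[≠] q, w x ≠ 0 := by
  obtain ⟨g, hg, hgw⟩ := hw q
  have hc := (chartAt ℂ q).continuousAt (mem_chart_source ℂ q)
  have hs := eventually_mem_chart_source q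
  rcases hg.eventually_eq_zero_or_eventually_ne_zero with h | h
  · left
    filter_upwards [hc.eventually h, hgw, hs] with x h1 h2 h3
    rw [h1] at h2
    exact (mul_eq_zero.1 h2.symm).resolve_right (preferredChartDeriv_ne_zero h3)
  · right
    rw [eventually_nhdsWithin_iff] at h ⊢
    filter_upwards [hc.eventually h, hgw, hs] with x h1 h2 h3 h4 h5
    refine h1 (fun e => h4 ((chartAt ℂ q).injOn h3 (mem_chart_source ℂ q) e)) ?_
    rw [h2, h5, zero_mul]

/-- Identity theorem: the points near which `w` vanishes identically form a clopen set, which misses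
`q₀`. -/
theorem IsFormCoefficient.dense_ne_zero [IsManifold 𝓘(ℂ) ω X] [PreconnectedSpace X]
    (hw : IsFormCoefficient w) {q₀ : X} (h0 : w q₀ ≠ 0) : Dense {x | w x ≠ 0} := by
  have hclopen : IsClopen {q | ∀ᶠ x in 𝓝 q, w x = 0} := by
    refine ⟨⟨?_⟩, isOpen_setOfPred_eventually_nhds⟩
    rw [isOpen_iff_mem_nhds]
    intro q hq
    have h := (hw.eventually_eq_zero_or q).resolve_left hq
    rw [eventually_nhdsWithin_iff, ← eventually_eventually_nhds] at h
    filter_upwards [h] with x hx hx'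
    have hx' : ∀ᶠ y in 𝓝 x, w y = 0 := hx'
    -- Near `q` the only possible zero is `q`. If `w` also vanished near `x`, then `x` would be
    -- isolated, which charts forbid.
    have h1 : ∀ᶠ y in 𝓝 x, y = q := by
      filter_upwards [hx, hx'] with y h1 h2
      by_contra h3
      exact h1 h3 h2
    have h2 : ∀ᶠ y in 𝓝[≠] x, False := by
      rw [eventually_nhdsWithin_iff]
      filter_upwards [h1] with y hy hyx
      exact hyx (hy.trans h1.self_of_nhds.symm)
    exact (Filter.eventually_false_iff_eq_bot.1 h2 ▸ neBot_nhdsWithin_ne_of_chartedSpace x).ne rfl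
  intro q
  rw [mem_closure_iff_frequently]
  intro hq
  rcases isClopen_iff.1 hclopen with h | h
  · have : q ∈ ({q | ∀ᶠ x in 𝓝 q, w x = 0} : Set X) := by
      filter_upwards [hq] with x hx
      simpa using hx
    rw [h] at this
    exact this
  · have : q₀ ∈ ({q | ∀ᶠ x in 𝓝 q, w x = 0} : Set X) := h ▸ Set.mem_univ q₀
    have this : ∀ᶠ x in 𝓝 q₀, w x = 0 := this
    exact h0 this.self_of_nhds

theorem IsFormCoefficient.isOpen_ne_zero [IsManifold 𝓘(ℂ) ω X] (hw : IsFormCoefficient w) :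
    IsOpen {x | w x ≠ 0} := by
  rw [isOpen_iff_mem_nhds]
  intro q hq
  obtain h | h := hw.eventually_eq_zero_or q
  · exact absurd h.self_of_nhds hq
  · rw [eventually_nhdsWithin_iff] at h
    filter_upwards [h] with x hx
    by_cases h : x = q
    · rwa [h]
    · exact hx h

/-- The coefficient of a holomorphic one-form in the preferred charts. -/
def formCoefficient [IsManifold 𝓘(ℂ) ω X] (η : HolomorphicOneForm X) (x : X) : ℂ := η x (1 : ℂ)

/-- The trivialization at `q` carries the vector 1 to the derivative at `x` of the change from the
chart at `q` to the one at `x`. This converts smoothness of a bundle section into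
`IsFormCoefficient`; the function `formCoefficient η` itself may jump with the preferred chart. -/
theorem inCoordinates_oneForm [IsManifold 𝓘(ℂ) ω X] (η : HolomorphicOneForm X) {q x : X}
    (hx : x ∈ (chartAt ℂ q).source) :
    ContinuousLinearMap.inCoordinates ℂ (TangentSpace 𝓘(ℂ)) ℂ (Bundle.Trivial X ℂ) q x q x (η x) 1 =
      formCoefficient η x * preferredChartDeriv q x := by
  have h1 : (trivializationAt ℂ (TangentSpace 𝓘(ℂ)) q).symmL ℂ x (1 : ℂ) =
      preferredChartDeriv q x • (1 : ℂ) := by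
    rw [TangentBundle.symmL_trivializationAt_eq_core hx, tangentBundleCore_coordChange_achart]
    simp [preferredChartDeriv, fderivWithin_univ]
    rfl
  have h2 : ContinuousLinearMap.inCoordinates ℂ (TangentSpace 𝓘(ℂ)) ℂ (Bundle.Trivial X ℂ) q x q x
      (η x) 1 = η x ((trivializationAt ℂ (TangentSpace 𝓘(ℂ)) q).symmL ℂ x (1 : ℂ)) := by
    simp [ContinuousLinearMap.inCoordinates]
  rw [h2, h1]
  refine ((η x).map_smul (preferredChartDeriv q x) (1 : ℂ)).trans ?_
  exact mul_comm _ _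

theorem ContMDiffAt.analyticAt_comp_chartAt_symm {F : Type*} [NormedAddCommGroup F]
    [NormedSpace ℂ F] {u : X → F} {q : X} (h : ContMDiffAt 𝓘(ℂ) 𝓘(ℂ, F) ω u q) :
    AnalyticAt ℂ (u ∘ (chartAt ℂ q).symm) (chartAt ℂ q q) := by
  exact ((contMDiffAt_iff.1 h).2.contDiffAt (by simp)).analyticAt

theorem isFormCoefficient_formCoefficient [IsManifold 𝓘(ℂ) ω X] (η : HolomorphicOneForm X) :
    IsFormCoefficient (formCoefficient η) := by
  intro q
  have h := ((contMDiffAt_hom_bundle _).1 (η.contMDiff q)).2.analyticAt_comp_chartAt_symm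
  refine ⟨_, (ContinuousLinearMap.apply ℂ ℂ (1 : ℂ)).analyticAt _ |>.comp h, ?_⟩
  filter_upwards [eventually_mem_chart_source q] with x hx
  rw [← inCoordinates_oneForm η hx]
  exact congrArg (fun y => ContinuousLinearMap.inCoordinates ℂ (TangentSpace 𝓘(ℂ)) ℂ
    (Bundle.Trivial X ℂ) q y q y (η y) 1) ((chartAt ℂ q).left_inv hx)

/-- Evaluation at `q` is a linear form on a space of dimension at least 2, so it is not injective.
-/
theorem exists_oneForm_apply_eq_zero [IsManifold 𝓘(ℂ) ω X] (hg : 2 ≤ genus X) (q : X) :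
    ∃ η : HolomorphicOneForm X, η ≠ 0 ∧ formCoefficient η q = 0 := by
  let ev : HolomorphicOneForm X →ₗ[ℂ] ℂ :=
    { toFun := fun η => formCoefficient η q
      map_add' := fun _ _ => rfl
      map_smul' := fun _ _ => rfl }
  by_contra! h
  have hinj : Function.Injective ev := by
    rw [injective_iff_map_eq_zero]
    intro η hη
    by_contra h0
    exact h η h0 hη
  have h1 := LinearMap.finrank_le_finrank_of_injective hinj
  rw [Module.finrank_self] at h1
  unfold genus at hg
  omega

/-- A Riemann surface of genus at least two carries a nonzero holomorphic one-form with a zero. -/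
theorem exists_isFormCoefficient [IsManifold 𝓘(ℂ) ω X] (hg : 2 ≤ genus X) (q : X) :
    ∃ w : X → ℂ, IsFormCoefficient w ∧ w q = 0 ∧ ∃ q₀, w q₀ ≠ 0 := by
  obtain ⟨η, h0, hq⟩ := exists_oneForm_apply_eq_zero hg q
  refine ⟨_, isFormCoefficient_formCoefficient η, hq, ?_⟩
  by_contra! h
  apply h0
  ext x
  exact h x

end Forms

/-! ### Configurations of distinct points -/

section Configurations

variable {X ι : Type*} [TopologicalSpace X] [T2Space X] [Finite ι]

theorem isOpen_setOf_injective : IsOpen {x : ι → X | Function.Injective x} := by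
  have : {x : ι → X | Function.Injective x} = ⋂ i, ⋂ j, ⋂ _ : i ≠ j, {x | x i ≠ x j} := by
    ext x
    simp only [Function.Injective, Set.mem_ofPred_eq, Set.mem_iInter]
    exact ⟨fun h i j hij e => hij (h e), fun h i j e => by_contra fun hij => h i j hij e⟩
  rw [this]
  exact isOpen_iInter_of_finite fun i => isOpen_iInter_of_finite fun j =>
    isOpen_iInter_of_finite fun _ => isOpen_ne_fun (continuous_apply i) (continuous_apply j)

/-- Each diagonal has dense complement, because one coordinate can be moved alone and X has no
isolated points. Compactness enters through Baire's theorem for the intersection. -/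
theorem dense_setOf_injective [CompactSpace X] [ChartedSpace ℂ X] :
    Dense {x : ι → X | Function.Injective x} := by
  classical
  have : {x : ι → X | Function.Injective x} =
      ⋂ q : {q : ι × ι // q.1 ≠ q.2}, {x | x q.1.1 ≠ x q.1.2} := by
    ext x
    simp only [Function.Injective, Set.mem_ofPred_eq, Set.mem_iInter, Subtype.forall, Prod.forall]
    exact ⟨fun h i j hij e => hij (h e), fun h i j e => by_contra fun hij => h i j hij e⟩
  rw [this]
  refine dense_iInter_of_isOpen (fun q => isOpen_ne_fun (continuous_apply _) (continuous_apply _)) ?_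
  rintro ⟨⟨i, j⟩, hij⟩ x
  have hc : Continuous fun t : X => Function.update x i t := continuous_const.update i continuous_id
  have hd : x i ∈ closure {t : X | t ≠ x j} := (dense_compl_singleton (x j)) (x i)
  have := map_mem_closure hc hd (t := {x : ι → X | x i ≠ x j}) (fun t ht => by
    simpa [Function.update_of_ne (Ne.symm hij)] using ht)
  simpa using this

theorem exists_injective_apply_eq [ChartedSpace ℂ X] (i : ι) (q : X) :
    ∃ x : ι → X, Function.Injective x ∧ x i = q := by
  classical
  have hinf : Infinite X := by
    refine Set.infinite_univ_iff.1 (infinite_of_mem_nhds q Filter.univ_mem)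
  obtain ⟨f⟩ : Nonempty (ι ↪ X) := ⟨(Finite.equivFin ι).toEmbedding.trans
    (Fin.valEmbedding.trans (Infinite.natEmbedding X))⟩
  -- Any injective configuration is corrected by the transposition that exchanges its `i`-th point
  -- with `q`.
  exact ⟨Equiv.swap (f i) q ∘ f, (Equiv.injective _).comp f.injective, by simp⟩

end Configurations

/-! ### Functions with poles along the diagonals -/

section Poles

open Function Filter

theorem Dense.eventually_eq_of_continuousAt {Y Z : Type*} [TopologicalSpace Y] [TopologicalSpace Z]
    [T2Space Z] {f g : Y → Z} {S : Set Y} {p : Y} (hS : Dense S)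
    (hf : ∀ᶠ x in 𝓝 p, ContinuousAt f x) (hg : ∀ᶠ x in 𝓝 p, ContinuousAt g x)
    (h : ∀ᶠ x in 𝓝 p, x ∈ S → f x = g x) : ∀ᶠ x in 𝓝 p, f x = g x := by
  rw [← eventually_eventually_nhds] at h
  filter_upwards [hf, hg, h] with x h1 h2 h3
  have := mem_closure_iff_nhdsWithin_neBot.1 (hS x)
  refine tendsto_nhds_unique_of_eventuallyEq (l := 𝓝[S] x) (h1.mono_left nhdsWithin_le_nhds)
    (h2.mono_left nhdsWithin_le_nhds) ?_
  exact eventually_nhdsWithin_iff.2 h3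

/-- Strict differentiability allows both ends of the difference quotient to move. It is used for the
ratio of the equations of a diagonal in two charts. -/
theorem HasStrictDerivAt.tendsto_div_sub {α : Type*} {l : Filter α} {f : ℂ → ℂ} {f' z : ℂ}
    (hf : HasStrictDerivAt f f' z) {u v : α → ℂ} (hu : Tendsto u l (𝓝 z)) (hv : Tendsto v l (𝓝 z))
    (huv : ∀ᶠ y in l, u y ≠ v y) :
    Tendsto (fun y => (f (u y) - f (v y)) / (u y - v y)) l (𝓝 f') := by
  have h1 := (hf.isLittleO.comp_tendsto (hu.prodMk_nhds hv)).tendsto_div_nhds_zero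
  have h2 := h1.add_const f'
  rw [zero_add] at h2
  refine h2.congr' ?_
  filter_upwards [huv] with y hy
  have : u y - v y ≠ 0 := sub_ne_zero.2 hy
  simp
  field_simp
  ring

/-! ### Local equations of sums of diagonals, and their behaviour under contraction -/

section DiagonalProduct

variable {X ι κ : Type*}

open Classical in
/-- The local equation near `p` of the divisor `∑ Δ_d`, where `d` ranges over `D`. -/
def diagonalProduct (D : Multiset (ι × ι)) (p : ι → X) (z : ι → ℂ) : ℂ :=
  (D.map fun d => if p d.1 = p d.2 then z d.1 - z d.2 else 1).prod

theorem continuous_diagonalProduct (D : Multiset (ι × ι)) (p : ι → X) :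
    Continuous (diagonalProduct D p) := by
  classical
  refine continuous_multiset_prod (f := fun d (z : ι → ℂ) =>
    if p d.1 = p d.2 then z d.1 - z d.2 else 1) D fun d _ => ?_
  split_ifs <;> fun_prop

open Classical in
/-- The part of `D` consisting of diagonals that contain the image of `x ↦ x ∘ σ`. -/
def contractedPart (σ : ι → κ) (D : Multiset (ι × ι)) : Multiset (ι × ι) :=
  D.filter fun d => σ d.1 = σ d.2

open Classical in
/-- The part of `D` consisting of diagonals that do not contain the image of `x ↦ x ∘ σ`. -/
def transversePart (σ : ι → κ) (D : Multiset (ι × ι)) : Multiset (ι × ι) :=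
  D.filter fun d => ¬ σ d.1 = σ d.2

theorem mem_contractedPart {σ : ι → κ} {D : Multiset (ι × ι)} {d : ι × ι} :
    d ∈ contractedPart σ D ↔ d ∈ D ∧ σ d.1 = σ d.2 := by
  classical exact Multiset.mem_filter

theorem mem_transversePart {σ : ι → κ} {D : Multiset (ι × ι)} {d : ι × ι} :
    d ∈ transversePart σ D ↔ d ∈ D ∧ ¬ σ d.1 = σ d.2 := by
  classical exact Multiset.mem_filter

/-- The divisor that the transverse part of `D` induces on the image of `x ↦ x ∘ σ`. -/
def restrictDivisor (σ : ι → κ) (D : Multiset (ι × ι)) : Multiset (κ × κ) :=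
  (transversePart σ D).map (Prod.map σ σ)

theorem diagonalProduct_comp (σ : ι → κ) (D : Multiset (ι × ι)) (p : κ → X) (z : ι → ℂ) :
    diagonalProduct D (p ∘ σ) z = ((contractedPart σ D).map fun d => z d.1 - z d.2).prod *
      diagonalProduct (transversePart σ D) (p ∘ σ) z := by
  classical
  unfold diagonalProduct contractedPart transversePart
  conv_lhs => rw [← Multiset.filter_add_not (fun d : ι × ι => σ d.1 = σ d.2) D]
  rw [Multiset.map_add, Multiset.prod_add]
  congr 2
  · refine Multiset.map_congr rfl fun d hd => ?_
    have := (Multiset.mem_filter.1 hd).2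
    simp [this]

theorem diagonalProduct_restrictDivisor (σ : ι → κ) (D : Multiset (ι × ι)) (p : κ → X)
    (z : κ → ℂ) : diagonalProduct (restrictDivisor σ D) p z =
      diagonalProduct (transversePart σ D) (p ∘ σ) (z ∘ σ) := by
  classical
  unfold diagonalProduct restrictDivisor
  rw [Multiset.map_map]
  rfl

/-- The transverse diagonals do not pass through `p ∘ σ` when `p` is injective, so they contribute
only factors 1. -/
theorem diagonalProduct_comp_of_injective (σ : ι → κ) (D : Multiset (ι × ι)) {p : κ → X}
    (hp : Injective p) (z : ι → ℂ) : diagonalProduct D (p ∘ σ) z =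
      ((contractedPart σ D).map fun d => z d.1 - z d.2).prod := by
  classical
  rw [diagonalProduct_comp]
  convert mul_one _
  refine Multiset.prod_eq_one fun a ha => ?_
  obtain ⟨d, hd, rfl⟩ := Multiset.mem_map.1 ha
  have := (mem_transversePart.1 hd).2
  simp [hp.eq_iff, this]

end DiagonalProduct

/-! ### Local numerators of functions with poles along the diagonals -/

variable {X : Type*} [TopologicalSpace X] [ChartedSpace ℂ X] {ι κ : Type*}

/-- The coordinates of `x` in the product of the preferred charts at the `p i`. -/
def chartCoord (p x : ι → X) : ι → ℂ := fun i => chartAt ℂ (p i) (x i)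

/-- Near `p`, and off the diagonals, `G` represents `h` times the local equation of `D`. -/
def IsLocalNumerator [Fintype ι] (D : Multiset (ι × ι)) (h : (ι → X) → ℂ) (p : ι → X)
    (G : (ι → ℂ) → ℂ) : Prop :=
  AnalyticAt ℂ G (chartCoord p p) ∧
    ∀ᶠ x in 𝓝 p, Injective x → G (chartCoord p x) = h x * diagonalProduct D p (chartCoord p x)

/-- `h` is, off the diagonals, a holomorphic function on `X^ι` with poles bounded by `D`. -/
def HasDiagonalPoles [Fintype ι] (D : Multiset (ι × ι)) (h : (ι → X) → ℂ) : Prop :=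
  ∀ p, ∃ G, IsLocalNumerator D h p G

theorem eventually_forall_mem_chart_source [Finite ι] (p : ι → X) :
    ∀ᶠ x in 𝓝 p, ∀ i, x i ∈ (chartAt ℂ (p i)).source :=
  eventually_all.2 fun i =>
    (continuous_apply i).continuousAt.eventually (eventually_mem_chart_source (p i))

theorem continuousAt_chartCoord {p x : ι → X} (hx : ∀ i, x i ∈ (chartAt ℂ (p i)).source) :
    ContinuousAt (chartCoord p) x :=
  continuousAt_pi.2 fun i => ((chartAt ℂ (p i)).continuousAt (hx i)).comp
    (f := fun x : ι → X => x i) (continuous_apply i).continuousAt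

theorem continuousAt_chartCoord_self (p : ι → X) : ContinuousAt (chartCoord p) p :=
  continuousAt_chartCoord fun i => mem_chart_source ℂ (p i)

theorem AnalyticAt.eventually_continuousAt_chartCoord [Fintype ι] {p : ι → X} {G : (ι → ℂ) → ℂ}
    (hG : AnalyticAt ℂ G (chartCoord p p)) :
    ∀ᶠ x in 𝓝 p, ContinuousAt (fun x => G (chartCoord p x)) x := by
  filter_upwards [(continuousAt_chartCoord_self p).eventually hG.eventually_analyticAt,
    eventually_forall_mem_chart_source p] with x h1 h2
  exact h1.continuousAt.comp (continuousAt_chartCoord h2)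

/-! #### The case without poles -/

theorem mdifferentiableAt_of_eventuallyEq_comp_chartAt [IsManifold 𝓘(ℂ) ω X] {f : X → ℂ} {q : X}
    {g : ℂ → ℂ} (hg : DifferentiableAt ℂ g (chartAt ℂ q q))
    (h : ∀ᶠ t in 𝓝 q, f t = g (chartAt ℂ q t)) : MDifferentiableAt 𝓘(ℂ) 𝓘(ℂ) f q := by
  have h1 : MDifferentiableAt 𝓘(ℂ) 𝓘(ℂ) (chartAt ℂ q) q :=
    mdifferentiableAt_atlas (chart_mem_atlas ℂ q) (mem_chart_source ℂ q)
  exact (hg.mdifferentiableAt.comp q h1).congr_of_eventuallyEq h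

theorem eq_of_forall_update_eq [Finite ι] [DecidableEq ι] {Y Z : Type*} {f : (ι → Y) → Z}
    (hf : ∀ x i t, f (update x i t) = f x) (x y : ι → Y) : f x = f y := by
  have := Fintype.ofFinite ι
  have h : ∀ s : Finset ι, f (s.piecewise y x) = f x := by
    intro s
    induction s using Finset.induction_on with
    | empty => simp
    | insert i s _ ih => rw [Finset.piecewise_insert, hf, ih]
  simpa using (h Finset.univ).symm

/-- In each variable separately `f` is holomorphic on a compact connected surface, hence constant
there; then the coordinates are changed one at a time. -/
theorem eq_of_forall_analyticAt [T2Space X] [CompactSpace X] [PreconnectedSpace X]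
    [IsManifold 𝓘(ℂ) ω X] [Fintype ι] {f : (ι → X) → ℂ}
    (hf : ∀ p, ∃ G : (ι → ℂ) → ℂ, AnalyticAt ℂ G (chartCoord p p) ∧
      ∀ᶠ x in 𝓝 p, f x = G (chartCoord p x)) (x y : ι → X) : f x = f y := by
  classical
  refine eq_of_forall_update_eq (fun x i t => ?_) x y
  have hmd : MDifferentiable 𝓘(ℂ) 𝓘(ℂ) fun t : X => f (update x i t) := by
    intro q
    obtain ⟨G, hG, hfG⟩ := hf (update x i q)
    set p := update x i q with hp
    have hpi : p i = q := by simp [hp]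
    have hcc : ∀ t, chartCoord p (update x i t) =
        update (chartCoord p p) i (chartAt ℂ q t) := by
      intro t
      funext l
      by_cases hl : l = i
      · subst hl; simp [chartCoord, hpi]
      · simp [chartCoord, hl, hp]
    refine mdifferentiableAt_of_eventuallyEq_comp_chartAt
      (g := fun z => G (update (chartCoord p p) i z)) ?_ ?_
    · have e : update (chartCoord p p) i (chartAt ℂ q q) = chartCoord p p := by
        rw [← hcc q]
      have h1 : DifferentiableAt ℂ G (update (chartCoord p p) i (chartAt ℂ q q)) :=
        e.symm ▸ hG.differentiableAt
      exact h1.comp (f := fun z : ℂ => update (chartCoord p p) i z) _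
        (hasFDerivAt_update (chartCoord p p) (chartAt ℂ q q)).differentiableAt
    · have hc : Continuous fun t : X => update x i t := continuous_const.update i continuous_id
      filter_upwards [hc.continuousAt.eventually hfG] with t ht
      rw [ht, hcc]
  have := hmd.apply_eq_of_compactSpace t (x i)
  simpa using this

/-- Without poles each numerator is a continuous local extension of `h` across the diagonals.
`extendFrom` glues these extensions into one global holomorphic function. -/
theorem HasDiagonalPoles.exists_eq_const_of_zero [T2Space X] [CompactSpace X] [PreconnectedSpace X]
    [IsManifold 𝓘(ℂ) ω X] [Fintype ι] {h : (ι → X) → ℂ}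
    (hh : HasDiagonalPoles (0 : Multiset (ι × ι)) h) : ∃ c, ∀ x, Injective x → h x = c := by
  set U : Set (ι → X) := {x | Injective x} with hU
  have hUd : Dense U := dense_setOf_injective
  have key : ∀ p G, IsLocalNumerator 0 h p G →
      ∀ᶠ x in 𝓝 p, extendFrom U h x = G (chartCoord p x) := by
    rintro p G ⟨hG, hGh⟩
    rw [← eventually_eventually_nhds] at hGh
    filter_upwards [hGh, hG.eventually_continuousAt_chartCoord] with x h1 h2
    refine extendFrom_eq (hUd x) ((h2.mono_left nhdsWithin_le_nhds).congr' ?_)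
    refine eventually_nhdsWithin_iff.2 ?_
    filter_upwards [h1] with y hy hyU
    simpa [diagonalProduct] using hy hyU
  have hconst := eq_of_forall_analyticAt (f := extendFrom U h) fun p => by
    obtain ⟨G, hG⟩ := hh p
    exact ⟨G, hG.1, key p G hG⟩
  rcases isEmpty_or_nonempty (ι → X) with he | ⟨⟨x₀⟩⟩
  · exact ⟨0, fun x => he.elim x⟩
  refine ⟨extendFrom U h x₀, fun x hx => ?_⟩
  obtain ⟨G, hG⟩ := hh x
  rw [← hconst x, (key x G hG).self_of_nhds, hG.2.self_of_nhds hx]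
  simp [diagonalProduct]

/-! #### Restriction to a diagonal -/

/-- This is the transformation law of the leading coefficient: a power of a tangent vector at the
`j`-th point, with poles along the restricted divisor. Both sides are limits, along injective `y`
tending to `x ∘ σ`, of `h y` times local equations. The transverse diagonals do not pass through `x
∘ σ`, and the contracted ones all collapse to `j`, so only one change of charts matters. -/
theorem IsLocalNumerator.eventually_restrict [T2Space X] [CompactSpace X] [IsManifold 𝓘(ℂ) ω X]
    [Fintype ι] [Fintype κ] {D : Multiset (ι × ι)} (hD : ∀ d ∈ D, d.1 ≠ d.2) {σ : ι → κ} {j : κ}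
    (hσ : ∀ d ∈ D, σ d.1 = σ d.2 → σ d.1 = j) {h : (ι → X) → ℂ} {p : κ → X} {G : (ι → ℂ) → ℂ}
    (hG : IsLocalNumerator D h (p ∘ σ) G) :
    ∀ᶠ x in 𝓝 p, Injective x → ∀ G', IsLocalNumerator D h (x ∘ σ) G' →
      G (chartCoord p x ∘ σ) * preferredChartDeriv (p j) (x j) ^ (contractedPart σ D).card =
        G' (chartCoord (x ∘ σ) (x ∘ σ)) *
          diagonalProduct (restrictDivisor σ D) p (chartCoord p x) := by
  classical
  have hσc : Continuous fun x : κ → X => x ∘ σ := by fun_prop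
  filter_upwards [hσc.continuousAt.eventually hG.1.eventually_continuousAt_chartCoord,
    hσc.continuousAt.eventually (eventually_eventually_nhds.2 hG.2),
    eventually_forall_mem_chart_source p] with x h1 h2 h3 hx G' hG'
  have : (𝓝[{y : ι → X | Injective y}] (x ∘ σ)).NeBot :=
    mem_closure_iff_nhdsWithin_neBot.1 (dense_setOf_injective _)
  set l := 𝓝[{y : ι → X | Injective y}] (x ∘ σ) with hl
  have hle : l ≤ 𝓝 (x ∘ σ) := nhdsWithin_le_nhds
  have hinj : ∀ᶠ y in l, Injective y := self_mem_nhdsWithin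
  set f : ℂ → ℂ := chartAt ℂ (x j) ∘ (chartAt ℂ (p j)).symm with hf
  have hfs : HasStrictDerivAt f (preferredChartDeriv (p j) (x j)) (chartAt ℂ (p j) (x j)) :=
    (analyticAt_preferredChartChange (h3 j)).hasStrictDerivAt
  have hcoord : ∀ d ∈ D, σ d.1 = σ d.2 → (σ d.1 = j ∧ σ d.2 = j) := fun d hd e =>
    ⟨hσ d hd e, e ▸ hσ d hd e⟩
  have hsrc : ∀ i, σ i = j → ∀ᶠ y in l, y i ∈ (chartAt ℂ (p j)).source := by
    intro i hi
    have hc : ContinuousAt (fun y : ι → X => y i) (x ∘ σ) := (continuous_apply i).continuousAt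
    refine hle (hc.eventually ((chartAt ℂ (p j)).open_source.mem_nhds ?_))
    simpa [hi] using h3 j
  have htend : ∀ i, σ i = j → Tendsto (fun y : ι → X => chartAt ℂ (p j) (y i)) l
      (𝓝 (chartAt ℂ (p j) (x j))) := by
    intro i hi
    have hc : ContinuousAt (fun y : ι → X => y i) (x ∘ σ) := (continuous_apply i).continuousAt
    have h4 := ((chartAt ℂ (p j)).continuousAt (h3 j)).tendsto
    have hc' : Tendsto (fun y : ι → X => y i) l (𝓝 (x j)) := by
      simpa [ContinuousAt, hi] using hc.tendsto.mono_left hle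
    exact h4.comp hc'
  -- The ratio of the equations of a contracted diagonal in the charts at `x j` and at `p j`; it
  -- tends to the derivative of the change of charts.
  set ρ : ι × ι → (ι → X) → ℂ := fun d y =>
    (f (chartAt ℂ (p j) (y d.1)) - f (chartAt ℂ (p j) (y d.2))) /
      (chartAt ℂ (p j) (y d.1) - chartAt ℂ (p j) (y d.2)) with hρ
  have hmem : ∀ d ∈ contractedPart σ D, d ∈ D ∧ σ d.1 = σ d.2 := fun d hd =>
    mem_contractedPart.1 hd
  have hne : ∀ d ∈ contractedPart σ D, ∀ᶠ y in l,
      chartAt ℂ (p j) (y d.1) ≠ chartAt ℂ (p j) (y d.2) := by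
    intro d hd
    obtain ⟨hd, e⟩ := hmem d hd
    filter_upwards [hinj, hsrc d.1 (hcoord d hd e).1, hsrc d.2 (hcoord d hd e).2] with y h5 h6 h7 h8
    exact hD d hd (h5 ((chartAt ℂ (p j)).injOn h6 h7 h8))
  have hρt : Tendsto (fun y => ((contractedPart σ D).map fun d => ρ d y).prod) l
      (𝓝 (preferredChartDeriv (p j) (x j) ^ (contractedPart σ D).card)) := by
    have := tendsto_multiset_prod (f := ρ) (x := l)
      (a := fun _ => preferredChartDeriv (p j) (x j)) (contractedPart σ D) fun d hd => by
        have hd' := hmem d hd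
        exact hfs.tendsto_div_sub (htend d.1 (hcoord d hd'.1 hd'.2).1)
          (htend d.2 (hcoord d hd'.1 hd'.2).2) (hne d hd)
    simpa using this
  have hleft := (h1.mono_left hle).mul hρt
  have hright := (((hG'.1.continuousAt.comp (continuousAt_chartCoord_self (x ∘ σ))).tendsto).mono_left
    hle).mul (((continuous_diagonalProduct (transversePart σ D)
      (p ∘ σ)).continuousAt.comp (continuousAt_chartCoord (p := p ∘ σ) (x := x ∘ σ)
        fun i => h3 (σ i))).tendsto.mono_left hle)
  rw [diagonalProduct_restrictDivisor]
  refine tendsto_nhds_unique_of_eventuallyEq hleft hright ?_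
  have hall : ∀ᶠ y in l, ∀ d ∈ contractedPart σ D,
      ρ d y * (chartCoord (p ∘ σ) y d.1 - chartCoord (p ∘ σ) y d.2) =
        chartCoord (x ∘ σ) y d.1 - chartCoord (x ∘ σ) y d.2 := by
    have : ∀ d ∈ (contractedPart σ D).toFinset, ∀ᶠ y in l,
      ρ d y * (chartCoord (p ∘ σ) y d.1 - chartCoord (p ∘ σ) y d.2) =
        chartCoord (x ∘ σ) y d.1 - chartCoord (x ∘ σ) y d.2 := by
      intro d hd
      rw [Multiset.mem_toFinset] at hd
      obtain ⟨hd', e⟩ := hmem d hd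
      obtain ⟨e1, e2⟩ := hcoord d hd' e
      filter_upwards [hne d hd, hsrc d.1 e1, hsrc d.2 e2] with y h6 h7 h8
      have : chartAt ℂ (p j) (y d.1) - chartAt ℂ (p j) (y d.2) ≠ 0 := sub_ne_zero.2 h6
      simp only [hρ, chartCoord, Function.comp_apply, e1, e2, div_mul_cancel₀ _ this, hf,
        (chartAt ℂ (p j)).left_inv h7, (chartAt ℂ (p j)).left_inv h8]
    simpa using (Finset.eventually_all _).2 this
  filter_upwards [hinj, hle h2, hle hG'.2, hall] with y h5 h6 h7 h8
  simp only [Function.comp_apply]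
  rw [h6 h5, h7 h5, diagonalProduct_comp_of_injective σ D hx, diagonalProduct_comp,
    ← Multiset.map_congr rfl h8, Multiset.prod_map_mul]
  ring

end Poles

/-! ### Functions with poles along the diagonals are constant -/

section Constancy

open Function Filter

variable {X : Type*} [TopologicalSpace X] [ChartedSpace ℂ X] {ι κ : Type*}

open Classical in
/-- The map contracting `k` to `j`. -/
def contract {j k : ι} (hjk : j ≠ k) (i : ι) : {i : ι // i ≠ k} :=
  if h : i = k then ⟨j, hjk⟩ else ⟨i, h⟩

theorem contract_of_ne {j k i : ι} (hjk : j ≠ k) (h : i ≠ k) : contract hjk i = ⟨i, h⟩ := by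
  simp [contract, h]

theorem contract_self {j k : ι} (hjk : j ≠ k) : contract hjk k = ⟨j, hjk⟩ := by
  simp [contract]

theorem contract_eq_of_eq {j k a b : ι} (hjk : j ≠ k) (hab : a ≠ b)
    (h : contract hjk a = contract hjk b) : contract hjk a = ⟨j, hjk⟩ := by
  by_cases ha : a = k
  · rw [ha, contract_self]
  · by_cases hb : b = k
    · rw [h, hb, contract_self]
    · rw [contract_of_ne hjk ha, contract_of_ne hjk hb] at h
      exact absurd (congrArg Subtype.val h) hab

variable {w : X → ℂ}

/-- The leading coefficient of `h` along the image of `x ↦ x ∘ σ`, paired with a one-form. -/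
theorem HasDiagonalPoles.restrict [T2Space X] [CompactSpace X] [IsManifold 𝓘(ℂ) ω X] [Fintype ι]
    [Fintype κ] (hw : IsFormCoefficient w) {D : Multiset (ι × ι)} (hD : ∀ d ∈ D, d.1 ≠ d.2)
    {σ : ι → κ} {j : κ} (hσ : ∀ d ∈ D, σ d.1 = σ d.2 → σ d.1 = j) {h : (ι → X) → ℂ}
    {N : (ι → X) → (ι → ℂ) → ℂ} (hN : ∀ p, IsLocalNumerator D h p (N p)) :
    HasDiagonalPoles (restrictDivisor σ D) fun x : κ → X =>
      N (x ∘ σ) (chartCoord (x ∘ σ) (x ∘ σ)) * w (x j) ^ (contractedPart σ D).card := by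
  intro p
  obtain ⟨g, hg, hgw⟩ := hw (p j)
  -- Each factor `g` contributes one factor `preferredChartDeriv`, exactly what the leading
  -- coefficient needs in order to pass from the chart at `p j` to the one at `x j`.
  refine ⟨fun z => N (p ∘ σ) (z ∘ σ) * g (z j) ^ (contractedPart σ D).card, ?_, ?_⟩
  · let L : (κ → ℂ) →L[ℂ] (ι → ℂ) := ContinuousLinearMap.pi fun i => ContinuousLinearMap.proj (σ i)
    have h1 : AnalyticAt ℂ (fun z : κ → ℂ => N (p ∘ σ) (L z)) (chartCoord p p) :=
      AnalyticAt.comp (g := N (p ∘ σ)) (f := L) (hN (p ∘ σ)).1 (L.analyticAt _)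
    have h2 : AnalyticAt ℂ (fun z : κ → ℂ => g (z j)) (chartCoord p p) :=
      AnalyticAt.comp (g := g) (f := fun z : κ → ℂ => z j) hg
        ((ContinuousLinearMap.proj (R := ℂ) (φ := fun _ : κ => ℂ) j).analyticAt _)
    exact h1.mul (h2.pow _)
  · filter_upwards [(hN (p ∘ σ)).eventually_restrict hD hσ,
      (continuous_apply j).continuousAt.eventually hgw] with x h1 h2 hx
    have h3 := h1 hx _ (hN (x ∘ σ))
    have h4 : g (chartCoord p x j) = w (x j) * preferredChartDeriv (p j) (x j) := h2
    rw [h4, mul_pow]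
    linear_combination w (x j) ^ (contractedPart σ D).card * h3

/-- Off the zeros of `w` the pairing with its power can be undone at injective configurations. The
remaining points follow by density and continuity of the numerator. -/
theorem IsLocalNumerator.eventually_eq_zero [T2Space X] [CompactSpace X] [PreconnectedSpace X]
    [IsManifold 𝓘(ℂ) ω X] [Fintype ι]
    [Fintype κ] (hw : IsFormCoefficient w) {q₀ : X} (hq₀ : w q₀ ≠ 0) {D : Multiset (ι × ι)}
    (hD : ∀ d ∈ D, d.1 ≠ d.2)
    {σ : ι → κ} {j : κ} (hσ : ∀ d ∈ D, σ d.1 = σ d.2 → σ d.1 = j) {h : (ι → X) → ℂ}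
    {N : (ι → X) → (ι → ℂ) → ℂ} (hN : ∀ p, IsLocalNumerator D h p (N p))
    (h0 : ∀ x : κ → X, Injective x →
      N (x ∘ σ) (chartCoord (x ∘ σ) (x ∘ σ)) * w (x j) ^ (contractedPart σ D).card = 0)
    (p : κ → X) : ∀ᶠ x in 𝓝 p, N (p ∘ σ) (chartCoord p x ∘ σ) = 0 := by
  have hσc : Continuous fun x : κ → X => x ∘ σ := by fun_prop
  have hS : Dense ({x : κ → X | Injective x} ∩ {x | w (x j) ≠ 0}) :=
    dense_setOf_injective.inter_of_isOpen_left
      ((hw.dense_ne_zero hq₀).preimage (isOpenMap_eval j)) isOpen_setOf_injective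
  refine hS.eventually_eq_of_continuousAt (g := fun _ => 0) ?_
    (Eventually.of_forall fun _ => continuousAt_const) ?_
  · filter_upwards [hσc.continuousAt.eventually
      (hN (p ∘ σ)).1.eventually_continuousAt_chartCoord] with x hx
    exact ContinuousAt.comp (g := fun y => N (p ∘ σ) (chartCoord (p ∘ σ) y)) hx hσc.continuousAt
  · filter_upwards [(hN (p ∘ σ)).eventually_restrict hD hσ, eventually_forall_mem_chart_source p]
      with x h1 h2 ⟨hx, hwx⟩
    have h3 := h1 hx _ (hN (x ∘ σ))
    have h4 := (mul_eq_zero.1 (h0 x hx)).resolve_right (pow_ne_zero _ hwx)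
    rw [h4, zero_mul] at h3
    exact (mul_eq_zero.1 h3).resolve_right (pow_ne_zero _ (preferredChartDeriv_ne_zero (h2 j)))

/-- Through `p` the numerator is divided by `z j - z k`. If the diagonal misses `p`, its local
equation there is 1 and the same numerator serves. -/
theorem IsLocalNumerator.of_cons [Fintype ι] {D : Multiset (ι × ι)} {j k : ι} (hjk : j ≠ k)
    {h : (ι → X) → ℂ} {p : ι → X} {G : (ι → ℂ) → ℂ} (hG : IsLocalNumerator ((j, k) ::ₘ D) h p G)
    (h0 : p j = p k → ∀ᶠ z in 𝓝 (chartCoord p p), z j = z k → G z = 0) :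
    ∃ G', IsLocalNumerator D h p G' := by
  by_cases hp : p j = p k
  · obtain ⟨Q, hQ, hGQ⟩ := hG.1.exists_eq_sub_mul hjk (by simp [chartCoord, hp]) (h0 hp)
    refine ⟨Q, hQ, ?_⟩
    filter_upwards [hG.2, (continuousAt_chartCoord_self p).eventually hGQ,
      eventually_forall_mem_chart_source p] with x h1 h2 h3 hx
    have h4 := h1 hx
    have hne : chartCoord p x j - chartCoord p x k ≠ 0 := by
      refine sub_ne_zero.2 fun e => hjk (hx ?_)
      have h3k := h3 k
      simp only [chartCoord, ← hp] at e h3k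
      exact (chartAt ℂ (p j)).injOn (h3 j) h3k e
    rw [h2, diagonalProduct, Multiset.map_cons, Multiset.prod_cons, if_pos hp] at h4
    refine mul_left_cancel₀ hne (h4.trans ?_)
    rw [diagonalProduct]
    ring
  · refine ⟨G, hG.1, ?_⟩
    filter_upwards [hG.2] with x hx hxi
    rw [hx hxi]
    simp [diagonalProduct, hp]

theorem eventually_eq_zero_of_contract [Fintype ι] {j k : ι} (hjk : j ≠ k)
    {p : ι → X} (hp : p j = p k) {G : (ι → ℂ) → ℂ}
    (h0 : ∀ᶠ x in 𝓝 (fun i : {i // i ≠ k} => p i),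
      G (chartCoord (fun i : {i // i ≠ k} => p i) x ∘ contract hjk) = 0) :
    ∀ᶠ z in 𝓝 (chartCoord p p), z j = z k → G z = 0 := by
  classical
  -- On `z j = z k` the coordinates with index other than `k` determine `z`; `s z` is the contracted
  -- configuration having these coordinates.
  let s : (ι → ℂ) → {i // i ≠ k} → X := fun z i => (chartAt ℂ (p i)).symm (z i)
  have hs : Tendsto s (𝓝 (chartCoord p p)) (𝓝 fun i : {i // i ≠ k} => p i) := by
    refine tendsto_pi_nhds.2 fun i => ?_
    have h1 := (chartAt ℂ (p i)).symm.continuousAt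
      ((chartAt ℂ (p i)).map_source (mem_chart_source ℂ (p i)))
    rw [ContinuousAt, (chartAt ℂ (p i)).left_inv (mem_chart_source ℂ (p i))] at h1
    exact h1.comp ((continuous_apply (i : ι)).tendsto (chartCoord p p))
  have htgt : ∀ᶠ z in 𝓝 (chartCoord p p), ∀ i, z i ∈ (chartAt ℂ (p i)).target :=
    eventually_all.2 fun i => ((continuous_apply i).tendsto (chartCoord p p)).eventually
      ((chartAt ℂ (p i)).open_target.mem_nhds
        ((chartAt ℂ (p i)).map_source (mem_chart_source ℂ (p i))))
  filter_upwards [hs.eventually h0, htgt] with z h1 h2 h3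
  convert h1 using 2
  funext i
  by_cases hi : i = k
  · subst hi
    simp [contract_self, chartCoord, s, (chartAt ℂ (p j)).right_inv (h2 j), ← h3]
  · simp [contract_of_ne hjk hi, chartCoord, s, (chartAt ℂ (p i)).right_inv (h2 i)]

/-- On a compact connected Riemann surface with a nonzero holomorphic one-form that has a zero,
functions on the powers of the surface with poles only along the diagonals are constant. -/
theorem HasDiagonalPoles.exists_eq_const [T2Space X] [CompactSpace X] [PreconnectedSpace X]
    [IsManifold 𝓘(ℂ) ω X] (hw : IsFormCoefficient w) {q q₀ : X} (hq : w q = 0) (hq₀ : w q₀ ≠ 0)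
    (ι : Type*) [Fintype ι] (D : Multiset (ι × ι)) (hD : ∀ d ∈ D, d.1 ≠ d.2) (h : (ι → X) → ℂ)
    (hh : HasDiagonalPoles D h) : ∃ c, ∀ x, Injective x → h x = c := by
  classical
  induction hn : Fintype.card ι using Nat.strong_induction_on generalizing ι with
  | _ n ih =>
  induction D using Multiset.induction_on with
  | empty => exact hh.exists_eq_const_of_zero
  | cons d D ihD =>
    obtain ⟨j, k⟩ := d
    have hjk : j ≠ k := hD _ (Multiset.mem_cons_self _ _)
    refine ihD (fun d hd => hD d (Multiset.mem_cons_of_mem hd)) fun p => ?_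
    choose N hN using hh
    set σ := contract hjk with hσdef
    have hσ : ∀ d ∈ (j, k) ::ₘ D, σ d.1 = σ d.2 → σ d.1 = ⟨j, hjk⟩ := fun d hd e =>
      contract_eq_of_eq hjk (hD d hd) e
    have hr := HasDiagonalPoles.restrict hw hD hσ hN
    have hcard : Fintype.card {i : ι // i ≠ k} < n := hn ▸ Fintype.card_subtype_lt (x := k) (by simp)
    obtain ⟨c, hc⟩ := ih _ hcard {i : ι // i ≠ k} _ (by
      intro d hd
      obtain ⟨e, he, rfl⟩ := Multiset.mem_map.1 hd
      exact (mem_transversePart.1 he).2) _ hr rfl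
    -- The exponent of `w` is positive since `(j, k)` itself is contracted; otherwise evaluation at
    -- `q` would not force `c = 0`.
    have hpos : (contractedPart σ ((j, k) ::ₘ D)).card ≠ 0 := by
      refine (Multiset.card_pos_iff_exists_mem.2 ?_).ne'
      refine ⟨(j, k), mem_contractedPart.2 ⟨Multiset.mem_cons_self _ _, ?_⟩⟩
      simp [hσdef, contract_self, contract_of_ne hjk hjk]
    have hc0 : c = 0 := by
      obtain ⟨x, hx, hxq⟩ := exists_injective_apply_eq (⟨j, hjk⟩ : {i : ι // i ≠ k}) q
      rw [← hc x hx, hxq, hq, zero_pow hpos, mul_zero]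
    subst hc0
    refine (hN p).of_cons hjk fun hp => eventually_eq_zero_of_contract hjk hp ?_
    -- As `p j = p k`, the configuration `p` factors through the contraction.
    have hpσ : (fun i : {i // i ≠ k} => p i) ∘ σ = p := by
      funext i
      by_cases hi : i = k
      · subst hi; simp [hσdef, contract_self, hp]
      · simp [hσdef, contract_of_ne hjk hi]
    have h1 := IsLocalNumerator.eventually_eq_zero hw hq₀ hD hσ hN hc fun i : {i // i ≠ k} => p i
    rwa [hpσ] at h1

end Constancy

/-! ### Sections of the twisted tangent bundle -/

section Sections

open Function Filter

variable {X : Type*} [TopologicalSpace X] [ChartedSpace ℂ X] {n : ℕ}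

theorem range_productModel (n : ℕ) : Set.range (productModel n) = Set.univ :=
  Set.range_eq_univ.2 fun z => ⟨z, rfl⟩

theorem ContMDiffAt.analyticAt_comp_extChartAt_symm {F : Type*} [NormedAddCommGroup F]
    [NormedSpace ℂ F] {u : (Fin n → X) → F} {p : Fin n → X}
    (h : ContMDiffAt (productModel n) 𝓘(ℂ, F) ω u p) :
    AnalyticAt ℂ (u ∘ (extChartAt (productModel n) p).symm) (chartCoord p p) :=
  ((contMDiffAt_iff.1 h).2.contDiffAt (by
    rw [range_productModel]; exact univ_mem)).analyticAt

theorem extChartAt_symm_chartCoord {p x : Fin n → X}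
    (hx : ∀ i, x i ∈ (chartAt ℂ (p i)).source) :
    (extChartAt (productModel n) p).symm (chartCoord p x) = x :=
  funext fun i => (chartAt ℂ (p i)).left_inv (hx i)

/-- Charts of the power are products of charts of X, so the derivative of a chart change is
diagonal, and `preferredChartDeriv (p i) (x i)` is the inverse of its `i`-th entry. -/
theorem tangentBundleCore_coordChange_apply [IsManifold 𝓘(ℂ) ω X] {p x : Fin n → X}
    (hx : ∀ i, x i ∈ (chartAt ℂ (p i)).source) (v : Fin n → ℂ) (i : Fin n) :
    (tangentBundleCore (productModel n) (Fin n → X)).coordChange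
        (achart (ModelPi fun _ : Fin n => ℂ) x) (achart (ModelPi fun _ : Fin n => ℂ) p) x v i *
      preferredChartDeriv (p i) (x i) = v i := by
  rw [tangentBundleCore_coordChange_achart, range_productModel,
    fderivWithin_univ]
  have h1 : ∀ i, HasFDerivAt (fun z : Fin n → ℂ => (chartAt ℂ (p i) ∘ (chartAt ℂ (x i)).symm) (z i))
      (deriv (chartAt ℂ (p i) ∘ (chartAt ℂ (x i)).symm) (chartAt ℂ (x i) (x i)) •
        ContinuousLinearMap.proj (R := ℂ) (φ := fun _ : Fin n => ℂ) i) (chartCoord x x) := by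
    intro i
    have h2 := (analyticAt_chartChange (achart ℂ (x i)) (achart ℂ (p i)) (mem_chart_source ℂ (x i))
      (hx i)).differentiableAt.hasDerivAt
    exact HasDerivAt.comp_hasFDerivAt (f := fun z : Fin n → ℂ => z i) (chartCoord x x) h2
      (ContinuousLinearMap.proj (R := ℂ) (φ := fun _ : Fin n => ℂ) i).hasFDerivAt
  have h3 : fderiv ℂ (extChartAt (productModel n) p ∘ (extChartAt (productModel n) x).symm)
      (extChartAt (productModel n) x x) = _ := (hasFDerivAt_pi.2 h1).fderiv
  rw [h3]
  have h4 := deriv_mul_preferredChartDeriv (hx i)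
  simp only [ContinuousLinearMap.coe_pi', _root_.smul_apply,
    ContinuousLinearMap.proj_apply, smul_eq_mul]
  linear_combination v i * h4

/-- The divisor `∑ m_{j,k} Δ_{j,k}` as a multiset of pairs. -/
def pairMultiset (m : DiagonalPair n → ℕ) : Multiset (Fin n × Fin n) :=
  ∑ q : DiagonalPair n, m q • {q.1}

theorem ne_of_mem_pairMultiset {m : DiagonalPair n → ℕ} {d : Fin n × Fin n}
    (hd : d ∈ pairMultiset m) : d.1 ≠ d.2 := by
  obtain ⟨q, -, hq⟩ := Multiset.mem_sum.1 hd
  have := Multiset.mem_singleton.1 (Multiset.mem_of_mem_nsmul hq)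
  exact this ▸ q.2.ne

theorem diagonalProduct_pairMultiset {Y : Type*} (m : DiagonalPair n → ℕ) (p : Fin n → Y)
    (z : Fin n → ℂ) :
    diagonalProduct (pairMultiset m) p z =
      ∏ q : DiagonalPair n, diagonalProduct {q.1} p z ^ m q := by
  classical
  unfold diagonalProduct pairMultiset
  rw [← Multiset.coe_mapAddMonoidHom, map_sum, Multiset.prod_sum]
  simp [Multiset.map_nsmul, Multiset.prod_nsmul]

/-- At an injective `x` the preferred index is `none` for every pair, with local equation 1. The
transition function to the index at `p` is therefore the local equation at `p` itself. -/
theorem diagonalDivisorBundle_coordChange [T2Space X] [IsManifold 𝓘(ℂ) ω X]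
    (m : DiagonalPair n → ℕ) (p : Fin n → X) {x : Fin n → X} (hx : Injective x) :
    (diagonalDivisorBundle X m).coordChange ((diagonalDivisorBundle X m).indexAt x)
      ((diagonalDivisorBundle X m).indexAt p) x 1 =
        diagonalProduct (pairMultiset m) p (chartCoord p x) := by
  rw [diagonalProduct_pairMultiset]
  simp only [diagonalDivisorBundle, tensorPowers, diagonalLineBundle, _root_.smul_apply,
    ContinuousLinearMap.id_apply, smul_eq_mul, mul_one]
  refine Finset.prod_congr rfl fun q _ => ?_
  congr 1
  have hne : x q.1.1 ≠ x q.1.2 := fun e => q.2.ne (hx e)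
  rw [if_neg hne]
  by_cases hp : p q.1.1 = p q.1.2
  · simp [diagonalTransition, hne, hp, diagonalEquation, diagonalProduct, chartCoord]
  · simp [diagonalTransition, hne, hp, diagonalEquation, diagonalProduct]

variable [T2Space X] [IsManifold 𝓘(ℂ) ω X] {m : DiagonalPair n → ℕ}

/-- The components of a section in the trivialization at `p`. -/
def localComponents (s : ∀ x, (twistedTangentBundle X m).Fiber x) (p x : Fin n → X) : Fin n → ℂ :=
  (twistedTangentBundle X m).coordChange ((twistedTangentBundle X m).indexAt x)
    ((twistedTangentBundle X m).indexAt p) x (s x)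

theorem localComponents_self (s : ∀ x, (twistedTangentBundle X m).Fiber x) (p : Fin n → X) :
    localComponents s p p = s p :=
  (twistedTangentBundle X m).coordChange_self _ p ((twistedTangentBundle X m).mem_baseSet_at p) _

theorem localComponents_mul (s : ∀ x, (twistedTangentBundle X m).Fiber x) {p x : Fin n → X}
    (hps : ∀ i, x i ∈ (chartAt ℂ (p i)).source) (hx : Injective x) (i : Fin n) :
    localComponents s p x i * preferredChartDeriv (p i) (x i) =
      (show Fin n → ℂ from s x) i * diagonalProduct (pairMultiset m) p (chartCoord p x) := by
  have h1 := tangentBundleCore_coordChange_apply hps (s x) i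
  have h2 := diagonalDivisorBundle_coordChange m p hx
  have h3 : localComponents s p x i =
      (diagonalDivisorBundle X m).coordChange ((diagonalDivisorBundle X m).indexAt x)
        ((diagonalDivisorBundle X m).indexAt p) x 1 *
      (tangentBundleCore (productModel n) (Fin n → X)).coordChange
        (achart (ModelPi fun _ : Fin n => ℂ) x) (achart (ModelPi fun _ : Fin n => ℂ) p) x (s x) i :=
    rfl
  rw [h3, h2, mul_assoc, h1]
  exact mul_comm _ _

theorem analyticAt_localComponents
    (s : Cₛ^ω⟮productModel n; Fin n → ℂ, (twistedTangentBundle X m).Fiber⟯) (p : Fin n → X) :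
    AnalyticAt ℂ (localComponents s p ∘ (extChartAt (productModel n) p).symm) (chartCoord p p) :=
  ((Bundle.contMDiffAt_section p).1 (s.contMDiff p)).analyticAt_comp_extChartAt_symm

/-- The `i`-th component is a tangent vector in the `i`-th variable, so its chart derivative cancels
against that of `w`, leaving only the equation of the divisor. -/
theorem hasDiagonalPoles_mul_form {w : X → ℂ} (hw : IsFormCoefficient w)
    (s : Cₛ^ω⟮productModel n; Fin n → ℂ, (twistedTangentBundle X m).Fiber⟯) (i : Fin n) :
    HasDiagonalPoles (pairMultiset m) fun x => (show Fin n → ℂ from s x) i * w (x i) := by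
  intro p
  obtain ⟨g, hg, hgw⟩ := hw (p i)
  refine ⟨fun z => (localComponents s p ∘ (extChartAt (productModel n) p).symm) z i * g (z i),
    ?_, ?_⟩
  · have h1 := ((ContinuousLinearMap.proj (R := ℂ) (φ := fun _ : Fin n => ℂ) i).analyticAt _).comp
      (analyticAt_localComponents s p)
    have h2 : AnalyticAt ℂ (fun z : Fin n → ℂ => g (z i)) (chartCoord p p) :=
      AnalyticAt.comp (g := g) (f := fun z : Fin n → ℂ => z i) hg
        ((ContinuousLinearMap.proj (R := ℂ) (φ := fun _ : Fin n => ℂ) i).analyticAt _)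
    exact h1.mul h2
  · filter_upwards [eventually_forall_mem_chart_source p,
      (continuous_apply i).continuousAt.eventually hgw] with x h1 h2 hx
    have h3 : g (chartCoord p x i) = w (x i) * preferredChartDeriv (p i) (x i) := h2
    have h4 := localComponents_mul s h1 hx i
    rw [h3, comp_apply, extChartAt_symm_chartCoord h1]
    linear_combination w (x i) * h4

theorem continuousAt_localComponents
    (s : Cₛ^ω⟮productModel n; Fin n → ℂ, (twistedTangentBundle X m).Fiber⟯) (p : Fin n → X) :
    ContinuousAt (localComponents s p) p :=
  ((Bundle.contMDiffAt_section p).1 (s.contMDiff p)).continuousAt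

theorem eq_zero_of_dense (s : Cₛ^ω⟮productModel n; Fin n → ℂ, (twistedTangentBundle X m).Fiber⟯)
    {S : Set (Fin n → X)} (hS : Dense S) (h : ∀ x ∈ S, s x = 0) : s = 0 := by
  ext1 p
  have := mem_closure_iff_nhdsWithin_neBot.1 (hS p)
  -- Values of `s` at different points are compared in the trivialization at `p`, where the
  -- components are continuous.
  refine (localComponents_self s p).symm.trans ?_
  refine tendsto_nhds_unique_of_eventuallyEq (l := 𝓝[S] p) (g := fun _ => 0)
    ((continuousAt_localComponents s p).mono_left nhdsWithin_le_nhds) tendsto_const_nhds ?_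
  filter_upwards [self_mem_nhdsWithin] with x hx
  unfold localComponents
  rw [h x hx]
  exact map_zero _

end Sections

end

/-! ### The vanishing theorem -/

theorem proposition2p3 (X : Type*) [TopologicalSpace X] [T2Space X] [CompactSpace X]
    [ConnectedSpace X] [ChartedSpace ℂ X] [IsManifold 𝓘(ℂ) ω X] (hg : 2 ≤ genus X)
    (n : ℕ) (hn : 1 ≤ n) (m : DiagonalPair n → ℕ)
    (s : Cₛ^ω⟮productModel n; Fin n → ℂ, (twistedTangentBundle X m).Fiber⟯) :
    s = 0 := by
  obtain ⟨q⟩ : Nonempty X := inferInstance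
  obtain ⟨w, hw, hq, q₀, hq₀⟩ := exists_isFormCoefficient hg q
  have hS : Dense ({x : Fin n → X | Function.Injective x} ∩ ⋂ i, {x | w (x i) ≠ 0}) := by
    refine dense_setOf_injective.inter_of_isOpen_left (dense_iInter_of_isOpen (fun i => ?_)
      fun i => (hw.dense_ne_zero hq₀).preimage (isOpenMap_eval i)) isOpen_setOf_injective
    have hc : Continuous fun x : Fin n → X => x i := continuous_apply i
    exact hw.isOpen_ne_zero.preimage hc
  refine eq_zero_of_dense s hS fun x hx => ?_
  refine funext fun i => ?_
  obtain ⟨c, hc⟩ := HasDiagonalPoles.exists_eq_const hw hq hq₀ (Fin n) _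
    (fun d hd => ne_of_mem_pairMultiset hd) _ (hasDiagonalPoles_mul_form hw s i)
  -- The constant is read off at distinct points with `q` in the `i`-th place, where the factor `w
  -- (y i)` is 0.
  obtain ⟨y, hy, hyq⟩ := exists_injective_apply_eq i q
  have h0 : c = 0 := by rw [← hc y hy, hyq, hq, mul_zero]
  exact (mul_eq_zero.1 ((hc x hx.1).trans h0)).resolve_right (Set.mem_iInter.1 hx.2 i)
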